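/- Setting. Let $S$ be a finite set with at least three elements, $\Sigma=2^S$, and let $\Omega=S^\infty$ be the set of sequences $\omega=(s_1,s_2,\dots)$ in $S$; let $\mathcal G_t$ be the algebra of events that depend on $s_1,\dots,s_t$ only and $\mathcal G=\sigma(\bigcup_t\mathcal G_t)$. Let $C$ be a compact metrizable space with at least two elements and $X$ the set of Borel probability measures on $C$ with the weak topology. A consumption plan is a sequence $h=(h_t)_{t\ge 0}$ of $\mathcal G_t$-measurable maps $h_t:\Omega\to X$; $\mathbf H$ is the set of plans and $\mathbf D=X^\infty$ the set of deterministic ones. For $h\in\mathbf H$ and $s\in S$ the continuation $h^{s,1}\in\mathbf H$ is $h^{s,1}(s_1,s_2,\dots)=(h_1(s),h_2(s,s_1),h_3(s,s_1,s_2),\dots)$. Mixtures of plans are formed period by period and state by state. For $K\subseteq\mathbb R$, $B(K,Y,\mathcal A)$ is the set of bounded $\mathcal A$-measurable functions $Y\to K$. A certainty equivalent is a functional $I:B(K,Y,\mathcal A)\to\mathbb R$ that is continuous along pointwise convergent sequences, monotone, and normalized ($I(k)=k$ for $k\in K$); it is translation invariant if $I(\xi+k)=I(\xi)+k$ whenever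 $\xi$ and $\xi+k$ belong to its domain. $\triangle(Y)$ is the set of finitely additive probabilities on $(Y,\mathcal A)$ with the weak* topology. A cost function is a map $c:\triangle(Y)\to[0,\infty]$ that is convex, lower semicontinuous, and grounded ($\inf c=0$). Let $\succsim$ be a binary relation on $\mathbf H$ with a separable recursive representation: there are a continuous $u:X\to\mathbb R$, a $\beta\in(0,1)$, a certainty equivalent $I_{+1}:B(U(\mathbf D),S,\Sigma)\to\mathbb R$, where $U(d)=\sum_{t\ge0}\beta^tu(d_t)$ for $d\in\mathbf D$, and a function $V:\mathbf H\to\mathbb R$ representing $\succsim$, such that for all $h\in\mathbf H$ the function $V\circ h^1:s\mapsto V(h^{s,1})$ belongs to $B(U(\mathbf D),S,\Sigma)$ and $V(h)=u(h_0)+\beta I_{+1}(V\circ h^1)$. Suppose that $u$ is affine and non-constant and that $\succsim$ is uncertainty averse: $h\sim g$ implies $\alpha h+(1-\alpha)g\succsim h$, for all $h,g\in\mathbf H$ and $\alpha\in(0,1)$. Then $\succsim$ satisfies state monotonicity (if $(h_t(\omega))_{t\ge0}\succsim(g_t(\omega))_{t\ge0}$ for all $\omega\in\Omega$, then $h\succsim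 g$) if and only if there exist cost functions $c_{+1}:\triangle(S)\to[0,\infty]$ and $c_0:\triangle(\Omega)\to[0,\infty]$ such that for all $h\in\mathbf H$ $$V(h)=u(h_0)+\beta\min_{\ell\in\triangle(S)}\left\{\mathbb E_\ell\left[V\circ h^1\right]+c_{+1}(\ell)\right\}\quad\text{and}\quad V(h)=\min_{P\in\triangle(\Omega)}\left\{\mathbb E_P\left[\sum_{t\ge0}\beta^tu(h_t)\right]+c_0(P)\right\}.$$ Moreover, if $\succsim$ satisfies state monotonicity, there is a translation invariant certainty equivalent $I_0:B(U(\mathbf D),\Omega,\mathcal G)\to\mathbb R$ with $V(h)=I_0\left(\sum_{t\ge0}\beta^tu(h_t)\right)$ for all $h\in\mathbf H$. -/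

import Mathlib

open Set Filter Topology MeasureTheory

noncomputable section

/-! ### Bounded measurable functions, certainty equivalents -/

/-- `B(K, Y, 𝒜)`: the bounded measurable functions on `Y` with values in `K ⊆ ℝ`. -/
def BddMeas (K : Set ℝ) (Y : Type*) [MeasurableSpace Y] : Set (Y → ℝ) :=
  {ξ | Measurable ξ ∧ (∀ y, ξ y ∈ K) ∧ ∃ M : ℝ, ∀ y, |ξ y| ≤ M}

/-- A certainty equivalent: a functional on `B(K, Y, 𝒜)` that is continuous along pointwise
convergent sequences, monotone and normalized. -/
structure IsCertaintyEquivalent {K : Set ℝ} {Y : Type*} [MeasurableSpace Y]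
    (I : BddMeas K Y → ℝ) : Prop where
  continuous : ∀ (ξs : ℕ → BddMeas K Y) (ξ : BddMeas K Y),
    (∀ y, Tendsto (fun n => (ξs n).1 y) atTop (𝓝 (ξ.1 y))) →
      Tendsto (fun n => I (ξs n)) atTop (𝓝 (I ξ))
  monotone : ∀ ξ ξ' : BddMeas K Y, (∀ y, ξ'.1 y ≤ ξ.1 y) → I ξ' ≤ I ξ
  normalized : ∀ (ξ : BddMeas K Y) (k : ℝ), k ∈ K → (∀ y, ξ.1 y = k) → I ξ = k

/-- Translation invariance: `I (ξ + k) = I ξ + k` whenever `ξ` and `ξ + k` are in the domain. -/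
def IsTranslationInvariant {K : Set ℝ} {Y : Type*} [MeasurableSpace Y]
    (I : BddMeas K Y → ℝ) : Prop :=
  ∀ (ξ ξ' : BddMeas K Y) (k : ℝ), (∀ y, ξ'.1 y = ξ.1 y + k) → I ξ' = I ξ + k

/-! ### Finitely additive probabilities, expectations, cost functions -/

/-- `Δ(Y)`: the finitely additive probability measures on the measurable subsets of `Y`. The
topology that it inherits as a subset of a product of copies of `ℝ` (pointwise convergence on
events) is its weak* topology, since simple functions are uniformly dense among the bounded
measurable functions. -/
def FinAddProb (Y : Type*) [MeasurableSpace Y] : Set ({A : Set Y // MeasurableSet A} → ℝ) :=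
  {P | (∀ A, 0 ≤ P A) ∧ P ⟨Set.univ, MeasurableSet.univ⟩ = 1 ∧
    ∀ A B : {A : Set Y // MeasurableSet A}, Disjoint A.1 B.1 →
      P ⟨A.1 ∪ B.1, A.2.union B.2⟩ = P A + P B}

/-- The integral of a simple function with respect to a finitely additive probability. -/
def simpleExpectation {Y : Type*} [MeasurableSpace Y] (P : FinAddProb Y)
    (f : SimpleFunc Y ℝ) : ℝ :=
  ∑ x ∈ f.range, x * P.1 ⟨f ⁻¹' {x}, f.measurableSet_fiber x⟩

/-- `E_P[ξ]` for a bounded measurable `ξ`: the supremum of the integrals of the simple functions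
below `ξ`. -/
def expectation {Y : Type*} [MeasurableSpace Y] (P : FinAddProb Y) (ξ : Y → ℝ) : ℝ :=
  sSup {r : ℝ | ∃ f : SimpleFunc Y ℝ, (∀ y, f y ≤ ξ y) ∧ r = simpleExpectation P f}

/-- A cost function `c : Δ(Y) → [0, ∞]`: convex, grounded (its infimum is zero) and (weak*) lower
semicontinuous. -/
structure IsCostFunction {Y : Type*} [MeasurableSpace Y] (c : FinAddProb Y → ENNReal) :
    Prop where
  convex : ∀ (P Q R : FinAddProb Y) (a b : ℝ), 0 ≤ a → 0 ≤ b → a + b = 1 →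
    R.1 = a • P.1 + b • Q.1 → c R ≤ ENNReal.ofReal a * c P + ENNReal.ofReal b * c Q
  grounded : ⨅ P, c P = 0
  lsc : LowerSemicontinuous c

/-- `m = min_{P ∈ Δ(Y)} { E_P[ξ] + c(P) }`, a minimum that is attained. -/
def IsVariationalMin {Y : Type*} [MeasurableSpace Y] (c : FinAddProb Y → ENNReal) (ξ : Y → ℝ)
    (m : ℝ) : Prop :=
  IsLeast (Set.range fun P : FinAddProb Y => ((expectation P ξ : ℝ) : EReal) + (c P : EReal))
    (m : EReal)

/-! ### Lotteries -/

/-- `X = Δ^σ(C)`: the Borel probability measures on `C`, with the topology of weak convergence. -/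
abbrev Lottery (C : Type*) [MeasurableSpace C] := ProbabilityMeasure C

/-- The mixture `α x + (1 - α) y` of two lotteries. -/
def Lottery.mix {C : Type*} [MeasurableSpace C] (α : unitInterval) (x y : Lottery C) :
    Lottery C :=
  ⟨ENNReal.ofReal α • (x : Measure C) + ENNReal.ofReal (1 - α) • (y : Measure C), ⟨by
    simp only [Measure.coe_add, Measure.coe_smul, Pi.add_apply, Pi.smul_apply, measure_univ,
      smul_eq_mul, mul_one]
    rw [← ENNReal.ofReal_add α.2.1 (sub_nonneg.2 α.2.2)]
    simp⟩⟩

/-- `u` is affine: `u (α x + (1 - α) y) = α u(x) + (1 - α) u(y)`. -/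
def IsAffineUtility {C : Type*} [MeasurableSpace C] (u : Lottery C → ℝ) : Prop :=
  ∀ (α : unitInterval) (x y : Lottery C), u (Lottery.mix α x y) = α * u x + (1 - α) * u y

/-! ### States and consumption plans

A state of the world is a sequence `ω : ℕ → S`, where `ω 0, ω 1, …` are the shocks
`s₁, s₂, …` of the periods `1, 2, …`; the full state space carries the product sigma-algebra. -/

/-- `𝒢_t`: the events that depend on the shocks `s₁, …, s_t` only. -/
@[reducible]
def infoAlgebra (S : Type*) [MeasurableSpace S] (t : ℕ) : MeasurableSpace (ℕ → S) :=
  cylinderEvents (X := fun _ : ℕ => S) (Set.Iio t)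

/-- With finitely many shocks, `𝒢_t`-measurability of a map into a T₁ space with its Borel
sigma-algebra means that the map depends on the first `t` shocks only. -/
theorem measurable_infoAlgebra_iff {S X : Type*} [Finite S] [MeasurableSpace S]
    [DiscreteMeasurableSpace S] [TopologicalSpace X] [T1Space X] (t : ℕ) (f : (ℕ → S) → X) :
    @Measurable _ _ (infoAlgebra S t) (borel X) f ↔ DependsOn f (Set.Iio t) := by
  have key : infoAlgebra S t =
      MeasurableSpace.comap (fun (ω : ℕ → S) (i : Set.Iio t) => ω i) MeasurableSpace.pi := by
    apply le_antisymm
    · refine iSup₂_le fun i hi => ?_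
      rintro _ ⟨B, hB, rfl⟩
      exact ⟨(fun g : Set.Iio t → S => g ⟨i, hi⟩) ⁻¹' B, measurable_pi_apply _ hB, rfl⟩
    · rw [← measurable_iff_comap_le]
      refine @measurable_pi_lambda _ _ _ (infoAlgebra S t) _ _ fun i => ?_
      exact measurable_cylinderEvent_apply i.2
  rw [key]
  constructor
  · intro hf ω ω' h
    have h1 : @MeasurableSet X (borel X) {f ω} := by
      borelize X
      exact measurableSet_singleton _
    obtain ⟨B, -, hB⟩ := hf h1
    have h2 : ω ∈ f ⁻¹' {f ω} := rfl
    have h3 : (fun i : Set.Iio t => ω i) = fun i : Set.Iio t => ω' i := funext fun i => h i i.2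
    rw [← hB, Set.mem_preimage, h3] at h2
    have h4 : ω' ∈ f ⁻¹' {f ω} := by rw [← hB]; exact h2
    exact h4.symm
  · intro hf A _
    refine ⟨(fun (ω : ℕ → S) (i : Set.Iio t) => ω i) '' (f ⁻¹' A), ?_, ?_⟩
    · exact (Set.toFinite _).measurableSet
    · ext ω
      constructor
      · rintro ⟨ω', h', h⟩
        have : f ω' = f ω := hf fun i hi => congrFun h ⟨i, hi⟩
        rw [Set.mem_preimage, ← this]
        exact h'
      · intro h
        exact ⟨ω, h, rfl⟩

/-- `𝐇`: the consumption plans, that is, the `(𝒢_t)`-adapted processes with values in the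
lotteries over `C` (with their Borel sigma-algebra). -/
structure Plan (S C : Type*) [MeasurableSpace S] [TopologicalSpace C] [MeasurableSpace C]
    [OpensMeasurableSpace C] where
  val : ℕ → (ℕ → S) → Lottery C
  adapted : ∀ t, @Measurable _ _ (infoAlgebra S t) (borel (Lottery C)) (val t)

/-- The state `(s, s₁, s₂, …)` obtained from the shock `s` followed by `(s₁, s₂, …)`. -/
def consState {S : Type*} (s : S) (ω : ℕ → S) : ℕ → S
  | 0 => s
  | n + 1 => ω n

/-- The deterministic plan that yields `d t` in period `t`. -/
def Plan.det {S C : Type*} [MeasurableSpace S] [TopologicalSpace C] [MeasurableSpace C]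
    [OpensMeasurableSpace C] (d : ℕ → Lottery C) : Plan S C where
  val t _ := d t
  adapted _ := measurable_const

/-- The continuation `h^{s,1}` of `h` after the first shock `s`: the plan
`(s₁, s₂, …) ↦ (h₁(s), h₂(s, s₁), h₃(s, s₁, s₂), …)`. -/
def Plan.continuation {S C : Type*} [MeasurableSpace S] [TopologicalSpace C] [MeasurableSpace C]
    [OpensMeasurableSpace C] (h : Plan S C) (s : S) : Plan S C where
  val t ω := h.val (t + 1) (consState s ω)
  adapted t := by
    refine @Measurable.comp _ _ _ (infoAlgebra S t) (infoAlgebra S (t + 1)) (borel _) _ _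
      (h.adapted (t + 1)) ?_
    refine (@measurable_cylinderEvents_iff _ _ _ (infoAlgebra S t) _ _ _).2 fun i hi => ?_
    cases i with
    | zero => exact measurable_const
    | succ j => exact measurable_cylinderEvent_apply (Set.mem_Iio.2 (Nat.lt_of_succ_lt_succ hi))

/-- The mixture `α h + (1 - α) g` of two plans, formed period by period and state by state. -/
def Plan.mix {S C : Type*} [Finite S] [MeasurableSpace S] [DiscreteMeasurableSpace S]
    [TopologicalSpace C] [TopologicalSpace.MetrizableSpace C] [MeasurableSpace C] [BorelSpace C]
    (α : unitInterval) (h g : Plan S C) : Plan S C where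
  val t ω := Lottery.mix α (h.val t ω) (g.val t ω)
  adapted t := by
    rw [measurable_infoAlgebra_iff]
    intro ω ω' hω
    show Lottery.mix α (h.val t ω) (g.val t ω) = Lottery.mix α (h.val t ω') (g.val t ω')
    rw [(measurable_infoAlgebra_iff t _).1 (h.adapted t) hω,
      (measurable_infoAlgebra_iff t _).1 (g.adapted t) hω]

/-! ### Preferences -/

/-- `U(d) = ∑_{t ≥ 0} β^t u(d_t)`. -/
def lifetimeUtility {C : Type*} [MeasurableSpace C] (u : Lottery C → ℝ) (β : ℝ)
    (d : ℕ → Lottery C) : ℝ :=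
  ∑' t, β ^ t * u (d t)

/-- `U(𝐃)`: the set of lifetime utilities of deterministic plans. -/
def lifetimeRange {C : Type*} [MeasurableSpace C] (u : Lottery C → ℝ) (β : ℝ) : Set ℝ :=
  Set.range (lifetimeUtility u β)

/-- `(V, I, u, β)` is a separable recursive representation of the relation `pref`
(`pref h g` means `h ≿ g`): `u` is continuous, `β ∈ (0, 1)`, `I` is a certainty equivalent on
`B(U(𝐃), S, 2^S)`, `V` represents `pref`, and `V ∘ h¹ : s ↦ V (h^{s,1})` lies in
`B(U(𝐃), S, 2^S)` with `V h = u(h₀) + β I (V ∘ h¹)` for every plan `h`. (The map `h₀` is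
constant, so `ω` is immaterial.) -/
structure IsSeparableRecursiveRep {S C : Type*} [MeasurableSpace S] [TopologicalSpace C]
    [MeasurableSpace C] [OpensMeasurableSpace C] (pref : Plan S C → Plan S C → Prop)
    (V : Plan S C → ℝ) (u : Lottery C → ℝ) (β : ℝ) (I : BddMeas (lifetimeRange u β) S → ℝ) :
    Prop where
  represents : ∀ h g, pref h g ↔ V g ≤ V h
  continuous_u : Continuous u
  beta_pos : 0 < β
  beta_lt_one : β < 1
  certaintyEquivalent : IsCertaintyEquivalent I
  recursion : ∀ h : Plan S C, ∃ ξ : BddMeas (lifetimeRange u β) S,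
    (∀ s, ξ.1 s = V (h.continuation s)) ∧ ∀ ω, V h = u (h.val 0 ω) + β * I ξ

/-- Uncertainty aversion: `h ∼ g` implies `α h + (1 - α) g ≿ h` for all `α ∈ (0, 1)`. -/
def UncertaintyAverse {S C : Type*} [Finite S] [MeasurableSpace S] [DiscreteMeasurableSpace S]
    [TopologicalSpace C] [TopologicalSpace.MetrizableSpace C] [MeasurableSpace C] [BorelSpace C]
    (pref : Plan S C → Plan S C → Prop) : Prop :=
  ∀ (h g : Plan S C) (α : unitInterval), 0 < α → α < 1 → pref h g → pref g h →
    pref (Plan.mix α h g) h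

/-- State monotonicity: if in every state `ω` the deterministic plan `(h_t(ω))_t` is weakly
preferred to `(g_t(ω))_t`, then `h` is weakly preferred to `g`. -/
def StateMonotone {S C : Type*} [MeasurableSpace S] [TopologicalSpace C] [MeasurableSpace C]
    [OpensMeasurableSpace C] (pref : Plan S C → Plan S C → Prop) : Prop :=
  ∀ h g : Plan S C,
    (∀ ω, pref (Plan.det fun t => h.val t ω) (Plan.det fun t => g.val t ω)) → pref h g

end

/-! Prepending a sure lottery `x` to `h` turns `V h` into `u x + β V h` and acts in the same affine
way on statewise utility (with the state shifted). A uniform gap between two plans can thus be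
worked off by prepending different lotteries, each period absorbing up to the spread of `u`. Once
the gap is zero, state monotonicity yields monotonicity and translation invariance of `V` in
statewise utility (`value_le_value_add`), and uncertainty aversion, which concerns indifferent plans
only, yields concavity (`le_value_mix`). Bets on the first shock carry these properties over to `I`.

A monotone, translation invariant, concave functional on a convex family has a supergradient at each
member by Riesz extension (`exists_supergradient`). It is a finitely additive probability and
attains the minimum for the conjugate cost `variationalCost`. Conversely, a variational value is
monotone in statewise utility.

For the ex ante certainty equivalent, the smallest extension of `V` is controlled only in the sup
norm. It is composed with a map `retract` that fixes plan utilities, respects order and constants,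
and turns pointwise into uniform convergence. -/

noncomputable section

/-! ### Integration against finitely additive probabilities. -/

section Expectation

variable {Y : Type*} [MeasurableSpace Y]

/-- A finitely additive probability as an operator-valued set function. -/
def finAddOperator (P : FinAddProb Y) (A : Set Y) : ℝ →L[ℝ] ℝ :=
  open Classical in
  if hA : MeasurableSet A then P.1 ⟨A, hA⟩ • ContinuousLinearMap.id ℝ ℝ else 0

theorem finAddOperator_apply (P : FinAddProb Y) {A : Set Y} (hA : MeasurableSet A) (x : ℝ) :
    finAddOperator P A x = P.1 ⟨A, hA⟩ * x := by
  simp [finAddOperator, hA]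

/-- With the zero measure as reference, the finiteness and integrability conditions on simple
functions hold automatically. -/
theorem finMeasAdditive_finAddOperator (P : FinAddProb Y) :
    FinMeasAdditive (0 : Measure Y) (finAddOperator P) := by
  intro A B hA hB _ _ hAB
  ext
  rw [add_apply, finAddOperator_apply P hA, finAddOperator_apply P hB,
    finAddOperator_apply P (hA.union hB), P.2.2.2 ⟨A, hA⟩ ⟨B, hB⟩ hAB]
  ring

theorem simpleExpectation_eq_setToSimpleFunc (P : FinAddProb Y) (f : SimpleFunc Y ℝ) :
    simpleExpectation P f = f.setToSimpleFunc (finAddOperator P) := by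
  refine Finset.sum_congr rfl fun x _ => ?_
  rw [finAddOperator_apply P (f.measurableSet_fiber x), mul_comm]

theorem simpleExpectation_add (P : FinAddProb Y) (f g : SimpleFunc Y ℝ) :
    simpleExpectation P (f + g) = simpleExpectation P f + simpleExpectation P g := by
  simp only [simpleExpectation_eq_setToSimpleFunc]
  exact SimpleFunc.setToSimpleFunc_add _ (finMeasAdditive_finAddOperator P)
    integrable_zero_measure integrable_zero_measure

theorem simpleExpectation_const (P : FinAddProb Y) (c : ℝ) :
    simpleExpectation P (SimpleFunc.const Y c) = c := by
  rw [simpleExpectation_eq_setToSimpleFunc, SimpleFunc.setToSimpleFunc_const _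
    (finMeasAdditive_finAddOperator P).map_empty_eq_zero,
    finAddOperator_apply P MeasurableSet.univ, P.2.2.1, one_mul]

theorem simpleExpectation_mono (P : FinAddProb Y) {f g : SimpleFunc Y ℝ} (h : ∀ y, f y ≤ g y) :
    simpleExpectation P f ≤ simpleExpectation P g := by
  simp only [simpleExpectation_eq_setToSimpleFunc]
  refine SimpleFunc.setToSimpleFunc_mono (μ := (0 : Measure Y))
    (finMeasAdditive_finAddOperator P) ?_ integrable_zero_measure integrable_zero_measure h
  intro A hA _ x hx
  rw [finAddOperator_apply P hA]
  exact mul_nonneg (P.2.1 _) hx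

theorem simpleExpectation_le_add (P : FinAddProb Y) {f g : SimpleFunc Y ℝ} {c : ℝ}
    (h : ∀ y, f y ≤ g y + c) : simpleExpectation P f ≤ simpleExpectation P g + c := by
  rw [← simpleExpectation_const P c, ← simpleExpectation_add]
  exact simpleExpectation_mono P h

theorem bddAbove_simpleExpectation (P : FinAddProb Y) {ξ : Y → ℝ} {M : ℝ} (hM : ∀ y, ξ y ≤ M) :
    BddAbove {r : ℝ | ∃ f : SimpleFunc Y ℝ, (∀ y, f y ≤ ξ y) ∧ r = simpleExpectation P f} := by
  refine ⟨M, ?_⟩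
  rintro _ ⟨f, hf, rfl⟩
  rw [← simpleExpectation_const P M]
  exact simpleExpectation_mono P fun y => (hf y).trans (hM y)

theorem simpleExpectation_le_expectation (P : FinAddProb Y) {ξ : Y → ℝ} {M : ℝ}
    (hM : ∀ y, ξ y ≤ M) {f : SimpleFunc Y ℝ} (hf : ∀ y, f y ≤ ξ y) :
    simpleExpectation P f ≤ expectation P ξ :=
  le_csSup (bddAbove_simpleExpectation P hM) ⟨f, hf, rfl⟩

theorem expectation_le_simpleExpectation_add (P : FinAddProb Y) {ξ : Y → ℝ} {m : ℝ}
    (hm : ∀ y, m ≤ ξ y) {f : SimpleFunc Y ℝ} {c : ℝ} (hf : ∀ y, ξ y ≤ f y + c) :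
    expectation P ξ ≤ simpleExpectation P f + c := by
  refine csSup_le ⟨_, SimpleFunc.const Y m, hm, rfl⟩ ?_
  rintro _ ⟨g, hg, rfl⟩
  exact simpleExpectation_le_add P fun y => (hg y).trans (hf y)

theorem expectation_mono (P : FinAddProb Y) {ξ η : Y → ℝ} {m M : ℝ} (hm : ∀ y, m ≤ ξ y)
    (hM : ∀ y, η y ≤ M) (h : ∀ y, ξ y ≤ η y) : expectation P ξ ≤ expectation P η := by
  refine csSup_le_csSup (bddAbove_simpleExpectation P hM) ⟨_, SimpleFunc.const Y m, hm, rfl⟩ ?_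
  rintro _ ⟨f, hf, rfl⟩
  exact ⟨f, fun y => (hf y).trans (h y), rfl⟩

theorem expectation_const (P : FinAddProb Y) (c : ℝ) : expectation P (fun _ => c) = c := by
  refine le_antisymm ?_ ?_
  · have h := expectation_le_simpleExpectation_add P (ξ := fun _ => c) (m := c) (fun _ => le_rfl)
      (f := SimpleFunc.const Y c) (c := 0) (fun y => by simp)
    simpa [simpleExpectation_const] using h
  · have h := simpleExpectation_le_expectation P (ξ := fun _ => c) (M := c) (fun _ => le_rfl)
      (f := SimpleFunc.const Y c) (fun y => by simp)
    rwa [simpleExpectation_const] at h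

/-- Bounded measurable functions are uniform limits of simple functions from below. -/
theorem exists_simpleFunc_le_le_add {ξ : Y → ℝ} (hξ : Measurable ξ) {M : ℝ}
    (hM : ∀ y, |ξ y| ≤ M) {ε : ℝ} (hε : 0 < ε) :
    ∃ f : SimpleFunc Y ℝ, (∀ y, f y ≤ ξ y) ∧ ∀ y, ξ y ≤ f y + ε := by
  -- Round `ξ` down to the grid of multiples of `ε`.
  have hmeas : Measurable fun y => (⌊ξ y / ε⌋ : ℝ) * ε :=
    ((measurable_from_top (f := fun k : ℤ => (k : ℝ))).comp
      (Int.measurable_floor.comp (hξ.div_const ε))).mul_const ε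
  have hfin : (range fun y => (⌊ξ y / ε⌋ : ℝ) * ε).Finite := by
    refine ((Set.finite_Icc ⌊-M / ε⌋ ⌊M / ε⌋).image fun k : ℤ => (k : ℝ) * ε).subset ?_
    rintro _ ⟨y, rfl⟩
    have := abs_le.1 (hM y)
    refine ⟨⌊ξ y / ε⌋, ⟨Int.floor_mono ?_, Int.floor_mono ?_⟩, rfl⟩
    · exact div_le_div_of_nonneg_right this.1 hε.le
    · exact div_le_div_of_nonneg_right this.2 hε.le
  refine ⟨⟨_, fun x => hmeas (measurableSet_singleton x), hfin⟩, fun y => ?_, fun y => ?_⟩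
  · exact (le_div_iff₀ hε).1 (Int.floor_le (ξ y / ε))
  · have := (div_lt_iff₀ hε).1 (Int.lt_floor_add_one (ξ y / ε))
    change ξ y ≤ (⌊ξ y / ε⌋ : ℝ) * ε + ε
    linarith

theorem continuous_simpleExpectation (f : SimpleFunc Y ℝ) :
    Continuous fun P : FinAddProb Y => simpleExpectation P f :=
  continuous_finsetSum _ fun _ _ =>
    continuous_const.mul ((continuous_apply _).comp continuous_subtype_val)

/-- A simple approximation of `ξ` has an error that is uniform in `P`, and its expectation is a
finite sum of coordinates of `P`. -/
theorem continuous_expectation {ξ : Y → ℝ} (hξ : Measurable ξ) {M : ℝ} (hM : ∀ y, |ξ y| ≤ M) :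
    Continuous fun P : FinAddProb Y => expectation P ξ := by
  refine continuous_of_uniform_approx_of_continuous fun W hW => ?_
  obtain ⟨ε, hε, hεW⟩ := Metric.mem_uniformity_dist.1 hW
  obtain ⟨f, hf, hf'⟩ := exists_simpleFunc_le_le_add hξ hM (half_pos hε)
  refine ⟨fun P => simpleExpectation P f, continuous_simpleExpectation f, fun P => hεW ?_⟩
  have h1 := simpleExpectation_le_expectation P (fun y => (abs_le.1 (hM y)).2) hf
  have h2 := expectation_le_simpleExpectation_add P (fun y => (abs_le.1 (hM y)).1) hf'
  rw [Real.dist_eq, abs_lt]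
  constructor <;> linarith

theorem expectation_convex_combination {P Q R : FinAddProb Y} {a b : ℝ} (ha : 0 ≤ a) (hb : 0 ≤ b)
    (hab : a + b = 1) (hR : R.1 = a • P.1 + b • Q.1) {ξ : Y → ℝ} (hξ : Measurable ξ) {M : ℝ}
    (hM : ∀ y, |ξ y| ≤ M) : expectation R ξ = a * expectation P ξ + b * expectation Q ξ := by
  refine eq_of_forall_dist_le fun ε hε => ?_
  obtain ⟨f, hf, hf'⟩ := exists_simpleFunc_le_le_add hξ hM hε
  have key : simpleExpectation R f = a * simpleExpectation P f + b * simpleExpectation Q f := by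
    simp only [simpleExpectation, hR, Finset.mul_sum, ← Finset.sum_add_distrib, Pi.add_apply,
      Pi.smul_apply, smul_eq_mul]
    exact Finset.sum_congr rfl fun _ _ => by ring
  have h1 (P : FinAddProb Y) :=
    simpleExpectation_le_expectation P (fun y => (abs_le.1 (hM y)).2) hf
  have h2 (P : FinAddProb Y) :=
    expectation_le_simpleExpectation_add P (fun y => (abs_le.1 (hM y)).1) hf'
  obtain rfl : b = 1 - a := by linarith
  rw [Real.dist_eq, abs_le]
  have := h1 R; have := h2 R
  have := mul_le_mul_of_nonneg_left (h1 P) ha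
  have := mul_le_mul_of_nonneg_left (h2 P) ha
  have := mul_le_mul_of_nonneg_left (h1 Q) hb
  have := mul_le_mul_of_nonneg_left (h2 Q) hb
  constructor <;> linarith

end Expectation

/-! ### Supergradients and the variational representation. -/

section Variational

/-- The vector space of bounded real functions. -/
def boundedFunctions (Y : Type*) : Submodule ℝ (Y → ℝ) where
  carrier := {ζ | ∃ M : ℝ, ∀ y, |ζ y| ≤ M}
  zero_mem' := ⟨0, fun y => by simp⟩
  add_mem' := by
    rintro f g ⟨M, hM⟩ ⟨N, hN⟩
    exact ⟨M + N, fun y => (abs_add_le _ _).trans (add_le_add (hM y) (hN y))⟩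
  smul_mem' := by
    rintro c f ⟨M, hM⟩
    refine ⟨|c| * M, fun y => ?_⟩
    rw [Pi.smul_apply, smul_eq_mul, abs_mul]
    exact mul_le_mul_of_nonneg_left (hM y) (abs_nonneg c)

theorem simpleFunc_mem_boundedFunctions {Y : Type*} [MeasurableSpace Y] (f : SimpleFunc Y ℝ) :
    ⇑f ∈ boundedFunctions Y := by
  obtain ⟨M, hM⟩ := f.exists_forall_norm_le
  exact ⟨M, hM⟩

/-- The indicator of an event as a bounded function. -/
def boundedIndicator {Y : Type*} (A : Set Y) : boundedFunctions Y :=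
  ⟨A.indicator 1, 1, fun y => by by_cases h : y ∈ A <;> simp [h]⟩

/-- A normalized positive linear functional is the expectation of a finitely additive
probability. -/
theorem exists_finAddProb_expectation_eq {Y : Type*} [MeasurableSpace Y]
    (L : boundedFunctions Y →ₗ[ℝ] ℝ) (hpos : ∀ ζ : boundedFunctions Y, (∀ y, 0 ≤ ζ.1 y) → 0 ≤ L ζ)
    (hone : L (boundedIndicator univ) = 1) :
    ∃ P : FinAddProb Y, ∀ ζ : boundedFunctions Y, Measurable ζ.1 → expectation P ζ.1 = L ζ := by
  have hadd : ∀ A B : Set Y, Disjoint A B →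
      boundedIndicator (A ∪ B) = boundedIndicator A + boundedIndicator B := by
    intro A B hAB
    exact Subtype.ext (indicator_union_of_disjoint hAB 1)
  let P : FinAddProb Y := ⟨fun A => L (boundedIndicator A.1),
    fun A => hpos _ fun y => indicator_nonneg (fun _ _ => zero_le_one) y, hone, fun A B hAB => by
      rw [← map_add, ← hadd _ _ hAB]⟩
  have hsimple : ∀ f : SimpleFunc Y ℝ,
      simpleExpectation P f = L ⟨f, simpleFunc_mem_boundedFunctions f⟩ := by
    intro f
    have h : (⟨f, simpleFunc_mem_boundedFunctions f⟩ : boundedFunctions Y) =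
        ∑ x ∈ f.range, x • boundedIndicator (f ⁻¹' {x}) := by
      refine Subtype.ext (funext fun y => ?_)
      rw [Submodule.coe_sum, Finset.sum_apply, Finset.sum_eq_single_of_mem (f y) (f.mem_range_self y)]
      · simp [boundedIndicator]
      · intro x _ hx
        simp [boundedIndicator, hx.symm]
    rw [h, map_sum]
    exact Finset.sum_congr rfl fun x _ => by rw [map_smul, smul_eq_mul]
  have hmono : ∀ ζ η : boundedFunctions Y, (∀ y, ζ.1 y ≤ η.1 y) → L ζ ≤ L η := by
    intro ζ η h
    have := hpos (η - ζ) fun y => sub_nonneg.2 (h y)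
    rw [map_sub] at this
    linarith
  refine ⟨P, fun ζ hζ => ?_⟩
  obtain ⟨M, hM⟩ := ζ.2
  refine eq_of_forall_dist_le fun ε hε => ?_
  obtain ⟨f, hf, hf'⟩ := exists_simpleFunc_le_le_add hζ hM hε
  have h1 := simpleExpectation_le_expectation P (fun y => (abs_le.1 (hM y)).2) hf
  have h2 := expectation_le_simpleExpectation_add P (fun y => (abs_le.1 (hM y)).1) hf'
  have h3 := hmono ⟨f, simpleFunc_mem_boundedFunctions f⟩ ζ hf
  have h4 := hmono ζ (⟨f, simpleFunc_mem_boundedFunctions f⟩ + ε • boundedIndicator univ) fun y => by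
    simpa [boundedIndicator] using hf' y
  rw [map_add, map_smul, hone, smul_eq_mul, mul_one] at h4
  rw [hsimple] at h1 h2
  rw [Real.dist_eq, abs_le]
  constructor <;> linarith

variable {ι Y : Type*} [MeasurableSpace Y]

/-- The data of a monotone, translation invariant and concave functional `F i ↦ v i` defined on a
convex family of bounded measurable functions that contains a constant. -/
structure IsVariationalFamily (F : ι → Y → ℝ) (v : ι → ℝ) : Prop where
  measurable : ∀ i, Measurable (F i)
  bounded : ∀ i, ∃ M : ℝ, ∀ y, |F i y| ≤ M
  -- `M = 0` is monotonicity; using `M` and `-M` together gives translation invariance.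
  le_add : ∀ i j M, (∀ y, F i y ≤ F j y + M) → v i ≤ v j + M
  concave : ∀ i j (a b : ℝ), 0 ≤ a → 0 ≤ b → a + b = 1 →
    ∃ k, (∀ y, F k y = a * F i y + b * F j y) ∧ a * v i + b * v j ≤ v k
  exists_const : ∃ i k, (F i = fun _ => k) ∧ v i = k

/-- The smallest cost function compatible with a functional. -/
def variationalCost (F : ι → Y → ℝ) (v : ι → ℝ) (P : FinAddProb Y) : ENNReal :=
  ⨆ i, ENNReal.ofReal (v i - expectation P (F i))

namespace IsVariationalFamily

variable {F : ι → Y → ℝ} {v : ι → ℝ}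

/-- The convex cone generated by the nonnegative functions and the functions
`F i - F i₀ - (v i - v i₀)`. -/
def supergradientCone (h : IsVariationalFamily F v) (i₀ : ι) :
    PointedCone ℝ (boundedFunctions Y) where
  carrier := {ζ | ∃ t : ℝ, 0 ≤ t ∧ ∃ i, ∀ y, t * (F i y - F i₀ y - (v i - v i₀)) ≤ ζ.1 y}
  zero_mem' := ⟨0, le_rfl, i₀, fun y => by simp⟩
  smul_mem' := by
    rintro ⟨c, hc⟩ ζ ⟨t, ht, i, hi⟩
    refine ⟨c * t, mul_nonneg hc ht, i, fun y => ?_⟩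
    change _ ≤ c * ζ.1 y
    rw [mul_assoc]
    exact mul_le_mul_of_nonneg_left (hi y) hc
  add_mem' := by
    rintro ζ η ⟨t, ht, i, hi⟩ ⟨r, hr, j, hj⟩
    rcases (add_nonneg ht hr).eq_or_lt with h0 | h0
    · obtain rfl : t = 0 := by linarith
      obtain rfl : r = 0 := by linarith
      refine ⟨0, le_rfl, i₀, fun y => ?_⟩
      have h1 := hi y
      have h2 := hj y
      rw [zero_mul] at h1 h2 ⊢
      exact add_nonneg h1 h2
    -- With weights normalized by `t + r`, concavity replaces the two members by a single `k` whose
    -- value is at least the average.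
    · obtain ⟨k, hk, hk'⟩ := h.concave i j (t / (t + r)) (r / (t + r)) (by positivity)
        (by positivity) (by field_simp)
      refine ⟨t + r, h0.le, k, fun y => ?_⟩
      refine le_trans ?_ (add_le_add (hi y) (hj y))
      have h3 := mul_le_mul_of_nonneg_left hk' h0.le
      have h4 : (t + r) * (t / (t + r) * v i + r / (t + r) * v j) = t * v i + r * v j := by
        field_simp
      have h5 : (t + r) * F k y = t * F i y + r * F j y := by
        rw [hk]; field_simp
      linear_combination h3 + h5 - h4

/-- Riesz extension of the functional `c ↦ c` on constants, made nonnegative on `supergradientCone`.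
The cone contains the nonnegative functions, so the extension is positive; it also contains `F i - F
i₀ - (v i - v i₀)`, which is the claim. -/
theorem exists_supergradient [Nonempty Y] (h : IsVariationalFamily F v) (i₀ : ι) :
    ∃ P : FinAddProb Y, ∀ i, v i - v i₀ ≤ expectation P (F i) - expectation P (F i₀) := by
  have hne : boundedIndicator (univ : Set Y) ≠ 0 := by
    intro h0
    have := congrFun (congrArg Subtype.val h0) (Classical.arbitrary Y)
    simp [boundedIndicator] at this
  let f : boundedFunctions Y →ₗ.[ℝ] ℝ :=
    LinearPMap.mkSpanSingleton (boundedIndicator (univ : Set Y)) (1 : ℝ) hne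
  have hnonneg : ∀ x : f.domain, (x : boundedFunctions Y) ∈ h.supergradientCone i₀ → 0 ≤ f x := by
    rintro ⟨x, hx⟩ hxs
    obtain ⟨c, rfl⟩ := Submodule.mem_span_singleton.1 hx
    obtain ⟨t, ht, i, hi⟩ := hxs
    have hfx : f ⟨c • boundedIndicator univ, hx⟩ = c :=
      (LinearPMap.mkSpanSingleton'_apply _ _ _ _ _).trans (mul_one c)
    rw [hfx]
    simp only [boundedIndicator, indicator_univ, Submodule.coe_smul, Pi.smul_apply, Pi.one_apply,
      smul_eq_mul, mul_one] at hi
    rcases ht.eq_or_lt with rfl | ht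
    · simpa using hi (Classical.arbitrary Y)
    -- A constant `c` in the cone gives `F i ≤ F i₀ + (v i - v i₀ + c / t)`, and `le_add` forces `c
    -- ≥ 0`.
    · have h1 := h.le_add i i₀ (v i - v i₀ + c / t) fun y => by
        have := (le_div_iff₀' ht).2 (hi y)
        linarith
      have h2 : 0 ≤ c / t := by linarith
      have := mul_nonneg h2 ht.le
      rwa [div_mul_cancel₀ _ ht.ne'] at this
  have hdense : ∀ ζ, ∃ x : f.domain,
      (x : boundedFunctions Y) + ζ ∈ h.supergradientCone i₀ := by
    rintro ⟨ζ, M, hM⟩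
    refine ⟨⟨M • boundedIndicator univ,
      Submodule.smul_mem _ _ (Submodule.mem_span_singleton_self _)⟩, 0, le_rfl, i₀, fun y => ?_⟩
    have := abs_le.1 (hM y)
    simp only [boundedIndicator, indicator_univ, zero_mul, Submodule.coe_add, Submodule.coe_smul,
      Pi.add_apply, Pi.smul_apply, Pi.one_apply, smul_eq_mul, mul_one]
    linarith
  obtain ⟨L, hL, hpos⟩ := riesz_extension (h.supergradientCone i₀) f hnonneg hdense
  have hone : L (boundedIndicator univ) = 1 :=
    (hL ⟨boundedIndicator univ, Submodule.mem_span_singleton_self _⟩).trans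
      (LinearPMap.mkSpanSingleton_apply ℝ ℝ hne (1 : ℝ))
  obtain ⟨P, hP⟩ := exists_finAddProb_expectation_eq L
    (fun ζ hζ => hpos ζ ⟨0, le_rfl, i₀, fun y => by simpa using hζ y⟩) hone
  refine ⟨P, fun i => ?_⟩
  have := hpos (⟨F i, h.bounded i⟩ - ⟨F i₀, h.bounded i₀⟩ - (v i - v i₀) • boundedIndicator univ)
    ⟨1, zero_le_one, i, fun y => by simp [boundedIndicator]⟩
  rw [map_sub, map_sub, map_smul, hone, ← hP _ (h.measurable i), ← hP _ (h.measurable i₀),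
    smul_eq_mul, mul_one] at this
  linarith

theorem isVariationalMin [Nonempty Y] (h : IsVariationalFamily F v) (i₀ : ι) :
    IsVariationalMin (variationalCost F v) (F i₀) (v i₀) := by
  constructor
  · obtain ⟨P, hP⟩ := h.exists_supergradient i₀
    obtain ⟨j, k, hj, hk⟩ := h.exists_const
    -- Comparison with the constant member; hence `ENNReal.ofReal` truncates nothing at `i₀`.
    have h0 : 0 ≤ v i₀ - expectation P (F i₀) := by
      have := hP j
      rw [hj, hk, expectation_const] at this
      linarith
    have hcost : variationalCost F v P = ENNReal.ofReal (v i₀ - expectation P (F i₀)) := by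
      refine le_antisymm (iSup_le fun i => ENNReal.ofReal_le_ofReal ?_)
        (le_iSup (fun i => ENNReal.ofReal (v i - expectation P (F i))) i₀)
      linarith [hP i]
    refine ⟨P, ?_⟩
    change ((expectation P (F i₀) : ℝ) : EReal) + (variationalCost F v P : EReal) = _
    rw [hcost, EReal.coe_ennreal_ofReal, max_eq_left h0, ← EReal.coe_add]
    congr 1
    ring
  · rintro _ ⟨P, rfl⟩
    have h1 : ((v i₀ - expectation P (F i₀) : ℝ) : EReal) ≤ (variationalCost F v P : EReal) := by
      have : ENNReal.ofReal (v i₀ - expectation P (F i₀)) ≤ variationalCost F v P :=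
        le_iSup (fun i => ENNReal.ofReal (v i - expectation P (F i))) i₀
      refine le_trans ?_ (EReal.coe_ennreal_le_coe_ennreal_iff.2 this)
      rw [EReal.coe_ennreal_ofReal]
      exact EReal.coe_le_coe_iff.2 (le_max_left _ _)
    calc ((v i₀ : ℝ) : EReal)
        = ((expectation P (F i₀) : ℝ) : EReal) + ((v i₀ - expectation P (F i₀) : ℝ) : EReal) := by
          rw [← EReal.coe_add]
          congr 1
          ring
      _ ≤ _ := add_le_add_right h1 _

/-- The cost is a supremum of positive parts of continuous affine functions of `P`, and a
supergradient at the constant member has cost zero. -/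
theorem isCostFunction [Nonempty Y] (h : IsVariationalFamily F v) :
    IsCostFunction (variationalCost F v) where
  convex P Q R a b ha hb hab hR := by
    refine iSup_le fun i => ?_
    obtain ⟨M, hM⟩ := h.bounded i
    rw [expectation_convex_combination ha hb hab hR (h.measurable i) hM]
    have : v i - (a * expectation P (F i) + b * expectation Q (F i)) =
        a * (v i - expectation P (F i)) + b * (v i - expectation Q (F i)) := by
      linear_combination (-v i) * hab
    rw [this]
    refine ENNReal.ofReal_add_le.trans ?_
    rw [ENNReal.ofReal_mul ha, ENNReal.ofReal_mul hb]
    gcongr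
    · exact le_iSup (fun i => ENNReal.ofReal (v i - expectation P (F i))) i
    · exact le_iSup (fun i => ENNReal.ofReal (v i - expectation Q (F i))) i
  grounded := by
    obtain ⟨j, k, hj, hk⟩ := h.exists_const
    obtain ⟨P, hP⟩ := h.exists_supergradient j
    refine le_antisymm (iInf_le_of_le P (iSup_le fun i => ?_)) bot_le
    have := hP i
    rw [hj, hk, expectation_const] at this
    rw [ENNReal.ofReal_of_nonpos (by linarith)]
  lsc := by
    refine lowerSemicontinuous_iSup fun i => Continuous.lowerSemicontinuous ?_
    obtain ⟨M, hM⟩ := h.bounded i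
    exact ENNReal.continuous_ofReal.comp
      (continuous_const.sub (continuous_expectation (h.measurable i) hM))

end IsVariationalFamily

end Variational

/-- `c` is the part of the gap `Δ` absorbed by one prepended period, where `w` is the spread of `u`.
-/
theorem exists_clip {Δ r w : ℝ} (hr : 0 ≤ r) (hw : 0 ≤ w) (h : |Δ| ≤ r + w) :
    ∃ c, |c| ≤ w ∧ |Δ - c| ≤ r := by
  rw [abs_le] at h
  rcases le_total Δ (-w) with h1 | h1
  · exact ⟨-w, abs_le.2 ⟨le_rfl, by linarith⟩, abs_le.2 ⟨by linarith, by linarith⟩⟩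
  rcases le_total w Δ with h2 | h2
  · exact ⟨w, abs_le.2 ⟨by linarith, le_rfl⟩, abs_le.2 ⟨by linarith, by linarith⟩⟩
  · exact ⟨Δ, abs_le.2 ⟨h1, h2⟩, by simpa using hr⟩

/-! ### Discounted utility of deterministic streams. -/

section Utility

variable {C : Type*} [MeasurableSpace C] {u : Lottery C → ℝ} {β : ℝ}

theorem exists_abs_utility_le [TopologicalSpace C] [CompactSpace C]
    [TopologicalSpace.MetrizableSpace C] [BorelSpace C] (hu : Continuous u) :
    ∃ B, ∀ x, |u x| ≤ B := by
  obtain ⟨B, hB⟩ := (isCompact_range hu).isBounded.exists_norm_le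
  exact ⟨B, fun x => hB _ ⟨x, rfl⟩⟩

theorem summable_discounted (hβ0 : 0 ≤ β) (hβ1 : β < 1) {B : ℝ} {a : ℕ → ℝ} (ha : ∀ t, |a t| ≤ B) :
    Summable fun t => β ^ t * a t := by
  refine Summable.of_norm_bounded ((summable_geometric_of_lt_one hβ0 hβ1).mul_right B) fun t => ?_
  rw [Real.norm_eq_abs, abs_mul, abs_of_nonneg (pow_nonneg hβ0 t)]
  exact mul_le_mul_of_nonneg_left (ha t) (pow_nonneg hβ0 t)

theorem abs_tsum_discounted_le (hβ0 : 0 ≤ β) (hβ1 : β < 1) {B : ℝ} {a : ℕ → ℝ}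
    (ha : ∀ t, |a t| ≤ B) : |∑' t, β ^ t * a t| ≤ B / (1 - β) := by
  have h := tsum_of_norm_bounded (f := fun t => β ^ t * a t)
    ((hasSum_geometric_of_lt_one hβ0 hβ1).mul_right B) fun t => by
      rw [Real.norm_eq_abs, abs_mul, abs_of_nonneg (pow_nonneg hβ0 t)]
      exact mul_le_mul_of_nonneg_left (ha t) (pow_nonneg hβ0 t)
  rwa [Real.norm_eq_abs, inv_mul_eq_div] at h

theorem lifetimeUtility_succ (hβ0 : 0 ≤ β) (hβ1 : β < 1) {B : ℝ} (hB : ∀ x, |u x| ≤ B)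
    (d : ℕ → Lottery C) :
    lifetimeUtility u β d = u (d 0) + β * lifetimeUtility u β fun t => d (t + 1) := by
  rw [lifetimeUtility, (summable_discounted hβ0 hβ1 fun t => hB (d t)).tsum_eq_zero_add, pow_zero,
    one_mul, lifetimeUtility, ← tsum_mul_left]
  congr 1
  exact tsum_congr fun t => by ring

theorem lifetimeUtility_const (hβ0 : 0 ≤ β) (hβ1 : β < 1) (x : Lottery C) :
    lifetimeUtility u β (fun _ => x) = u x / (1 - β) := by
  rw [lifetimeUtility, tsum_mul_right, tsum_geometric_of_lt_one hβ0 hβ1, inv_mul_eq_div]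

theorem lifetimeUtility_mix (haff : IsAffineUtility u) (hβ0 : 0 ≤ β) (hβ1 : β < 1) {B : ℝ}
    (hB : ∀ x, |u x| ≤ B) (α : unitInterval) (d e : ℕ → Lottery C) :
    lifetimeUtility u β (fun t => Lottery.mix α (d t) (e t)) =
      α * lifetimeUtility u β d + (1 - α) * lifetimeUtility u β e := by
  simp only [lifetimeUtility]
  rw [← tsum_mul_left, ← tsum_mul_left, ← Summable.tsum_add
    ((summable_discounted hβ0 hβ1 fun t => hB (d t)).mul_left _)
    ((summable_discounted hβ0 hβ1 fun t => hB (e t)).mul_left _)]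
  exact tsum_congr fun t => by rw [haff]; ring

theorem IsAffineUtility.exists_eq (haff : IsAffineUtility u) {x y : Lottery C} {v : ℝ}
    (hx : u x ≤ v) (hy : v ≤ u y) : ∃ z, u z = v := by
  rcases (hx.trans hy).eq_or_lt with h | h
  · exact ⟨x, le_antisymm hx (h ▸ hy)⟩
  · have h0 : 0 < u y - u x := sub_pos.2 h
    refine ⟨Lottery.mix ⟨(v - u x) / (u y - u x), div_nonneg (sub_nonneg.2 hx) h0.le,
      (div_le_one h0).2 (by linarith)⟩ y x, ?_⟩
    rw [haff]
    field_simp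
    ring

theorem IsAffineUtility.exists_sub_eq (haff : IsAffineUtility u) {x₀ y₀ : Lottery C} {δ : ℝ}
    (hδ : |δ| ≤ u x₀ - u y₀) : ∃ x y, u x - u y = δ := by
  rw [abs_le] at hδ
  rcases le_total 0 δ with h | h
  · obtain ⟨z, hz⟩ := haff.exists_eq (x := y₀) (y := x₀) (v := u y₀ + δ) (by linarith)
      (by linarith)
    exact ⟨z, y₀, by linarith⟩
  · obtain ⟨z, hz⟩ := haff.exists_eq (x := y₀) (y := x₀) (v := u y₀ - δ) (by linarith)
      (by linarith)
    exact ⟨y₀, z, by linarith⟩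

/-- `(1 - β) k` is a weighted average of the `u (d t)`, so it lies between two of them, and affinity
of `u` supplies a lottery in between. -/
theorem exists_utility_eq_of_mem_lifetimeRange (haff : IsAffineUtility u) (hβ0 : 0 ≤ β)
    (hβ1 : β < 1) {B : ℝ} (hB : ∀ x, |u x| ≤ B) {k : ℝ} (hk : k ∈ lifetimeRange u β) :
    ∃ x, u x / (1 - β) = k := by
  obtain ⟨d, rfl⟩ := hk
  have h1 : 0 < 1 - β := sub_pos.2 hβ1
  set k := lifetimeUtility u β d with hk
  have hs := summable_discounted hβ0 hβ1 fun t => hB (d t)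
  have hs' := (summable_geometric_of_lt_one hβ0 hβ1).mul_right ((1 - β) * k)
  have hsum : ∑' t, β ^ t * ((1 - β) * k) = k := by
    rw [tsum_mul_right, tsum_geometric_of_lt_one hβ0 hβ1, inv_mul_cancel_left₀ h1.ne']
  have hlow : ∃ t, u (d t) ≤ (1 - β) * k := by
    by_contra! h
    have := hs'.tsum_lt_tsum (i := 0)
      (fun t => mul_le_mul_of_nonneg_left (h t).le (pow_nonneg hβ0 t)) (by simpa using h 0) hs
    rw [hsum] at this
    exact this.ne hk
  have hupp : ∃ t, (1 - β) * k ≤ u (d t) := by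
    by_contra! h
    have := hs.tsum_lt_tsum (i := 0)
      (fun t => mul_le_mul_of_nonneg_left (h t).le (pow_nonneg hβ0 t)) (by simpa using h 0) hs'
    rw [hsum] at this
    exact this.ne hk.symm
  obtain ⟨t, ht⟩ := hlow
  obtain ⟨r, hr⟩ := hupp
  obtain ⟨x, hx⟩ := haff.exists_eq ht hr
  exact ⟨x, by rw [hx]; field_simp⟩

theorem convex_lifetimeRange (haff : IsAffineUtility u) (hβ0 : 0 ≤ β) (hβ1 : β < 1) {B : ℝ}
    (hB : ∀ x, |u x| ≤ B) : Convex ℝ (lifetimeRange u β) := by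
  rintro _ ⟨d, rfl⟩ _ ⟨e, rfl⟩ a b ha hb hab
  obtain rfl : b = 1 - a := by linarith
  exact ⟨_, lifetimeUtility_mix haff hβ0 hβ1 hB ⟨a, ha, by linarith⟩ d e⟩

end Utility

/-! ### Prepended plans, bets and statewise utility. -/

section Plans

variable {S C : Type*} [MeasurableSpace S] [TopologicalSpace C] [MeasurableSpace C]
  [OpensMeasurableSpace C]

/-- The lifetime utility of a plan as a function of the state. -/
def planUtility (u : Lottery C → ℝ) (β : ℝ) (h : Plan S C) (ω : ℕ → S) : ℝ :=
  lifetimeUtility u β fun t => h.val t ω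

theorem Plan.ext_val {h g : Plan S C} (hv : ∀ t, h.val t = g.val t) : h = g := by
  cases h
  cases g
  congr
  exact funext hv

/-- The plan that yields `x` in period `0` and, whatever the first shock, continues with `h`. -/
def Plan.prepend (x : Lottery C) (h : Plan S C) : Plan S C where
  val
    | 0 => fun _ => x
    | t + 1 => fun ω => h.val t fun i => ω (i + 1)
  adapted
    | 0 => measurable_const
    | t + 1 => by
      refine @Measurable.comp _ _ _ (infoAlgebra S (t + 1)) (infoAlgebra S t) (borel _) _ _
        (h.adapted t) ?_
      refine (@measurable_cylinderEvents_iff _ _ _ (infoAlgebra S (t + 1)) _ _ _).2 fun i hi => ?_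
      exact measurable_cylinderEvent_apply (Set.mem_Iio.2 (Nat.succ_lt_succ hi))

theorem Plan.continuation_prepend (x : Lottery C) (h : Plan S C) (s : S) :
    (Plan.prepend x h).continuation s = h :=
  rfl

theorem Plan.continuation_det (d : ℕ → Lottery C) (s : S) :
    (Plan.det d).continuation s = Plan.det fun t => d (t + 1) :=
  rfl

/-- The plan that yields `x` in period `0` and, from period `1` on, a constant lottery that depends
on the first shock. -/
def Plan.bet [Finite S] [DiscreteMeasurableSpace S] (x : Lottery C) (y : S → Lottery C) :
    Plan S C where
  val
    | 0 => fun _ => x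
    | _ + 1 => fun ω => y (ω 0)
  adapted
    | 0 => measurable_const
    | t + 1 => by
      refine @Measurable.comp _ _ _ (infoAlgebra S (t + 1)) _ (borel _) y _
        (fun _ _ => MeasurableSet.of_discrete) ?_
      exact measurable_cylinderEvent_apply (X := fun _ : ℕ => S) (Set.mem_Iio.2 t.succ_pos)

theorem Plan.continuation_bet [Finite S] [DiscreteMeasurableSpace S] (x : Lottery C)
    (y : S → Lottery C) (s : S) : (Plan.bet x y).continuation s = Plan.det fun _ => y s :=
  rfl

variable {u : Lottery C → ℝ} {β : ℝ}

theorem planUtility_prepend (hβ0 : 0 ≤ β) (hβ1 : β < 1) {B : ℝ} (hB : ∀ x, |u x| ≤ B)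
    (x : Lottery C) (h : Plan S C) (ω : ℕ → S) :
    planUtility u β (Plan.prepend x h) ω = u x + β * planUtility u β h fun i => ω (i + 1) :=
  lifetimeUtility_succ hβ0 hβ1 hB _

theorem planUtility_bet [Finite S] [DiscreteMeasurableSpace S] (hβ0 : 0 ≤ β) (hβ1 : β < 1) {B : ℝ}
    (hB : ∀ x, |u x| ≤ B) (x : Lottery C) (y : S → Lottery C) (ω : ℕ → S) :
    planUtility u β (Plan.bet x y) ω = u x + β * (u (y (ω 0)) / (1 - β)) := by
  rw [← lifetimeUtility_const hβ0 hβ1]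
  exact lifetimeUtility_succ hβ0 hβ1 hB _

theorem abs_planUtility_le (hβ0 : 0 ≤ β) (hβ1 : β < 1) {B : ℝ} (hB : ∀ x, |u x| ≤ B)
    (h : Plan S C) (ω : ℕ → S) : |planUtility u β h ω| ≤ B / (1 - β) :=
  abs_tsum_discounted_le hβ0 hβ1 fun _ => hB _

theorem measurable_planUtility (hu : Continuous u) (hβ0 : 0 ≤ β) (hβ1 : β < 1) {B : ℝ}
    (hB : ∀ x, |u x| ≤ B) (h : Plan S C) : Measurable (planUtility u β h) := by
  have hterm : ∀ t, Measurable fun ω => β ^ t * u (h.val t ω) := by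
    intro t
    refine Measurable.const_mul ?_ _
    have h1 : @Measurable _ _ MeasurableSpace.pi (borel (Lottery C)) (h.val t) :=
      (h.adapted t).mono cylinderEvents_le_pi le_rfl
    exact @Measurable.comp _ _ _ _ (borel (Lottery C)) _ u _
      (hu.borel_measurable.mono le_rfl (le_of_eq BorelSpace.measurable_eq)) h1
  refine measurable_of_tendsto_metrizable
    (fun n => Finset.measurable_sum (Finset.range n) fun t _ => hterm t) ?_
  refine tendsto_pi_nhds.2 fun ω => ?_
  exact (summable_discounted hβ0 hβ1 fun t => hB (h.val t ω)).hasSum.tendsto_sum_nat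

end Plans

/-! ### Values of plans under the recursion, and translation invariance. -/

section Representation

variable {S C : Type*} [MeasurableSpace S] [TopologicalSpace C] [MeasurableSpace C]
  [OpensMeasurableSpace C] {pref : Plan S C → Plan S C → Prop} {V : Plan S C → ℝ}
  {u : Lottery C → ℝ} {β : ℝ} {I : BddMeas (lifetimeRange u β) S → ℝ}

namespace IsSeparableRecursiveRep

variable [Nonempty S]

/-- The recursion restricts the values of continuations only, but every plan is a continuation of a
prepended one. -/
theorem value_mem_lifetimeRange [Nonempty (Lottery C)]
    (hrep : IsSeparableRecursiveRep pref V u β I) (h : Plan S C) :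
    V h ∈ lifetimeRange u β := by
  obtain ⟨ξ, hξ, -⟩ := hrep.recursion (Plan.prepend (Classical.arbitrary _) h)
  have := ξ.2.2.1 (Classical.arbitrary S)
  rwa [hξ] at this

theorem value_of_continuation_eq [Nonempty (Lottery C)]
    (hrep : IsSeparableRecursiveRep pref V u β I) {h g : Plan S C} (x : Lottery C)
    (h0 : h.val 0 = fun _ => x) (hg : ∀ s, h.continuation s = g) : V h = u x + β * V g := by
  obtain ⟨ξ, hξ, hV⟩ := hrep.recursion h
  rw [hV fun _ => Classical.arbitrary S, h0,
    hrep.certaintyEquivalent.normalized ξ (V g) (hrep.value_mem_lifetimeRange g) fun s => by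
      rw [hξ, hg]]

theorem value_prepend (hrep : IsSeparableRecursiveRep pref V u β I) (x : Lottery C)
    (h : Plan S C) : V (Plan.prepend x h) = u x + β * V h :=
  have : Nonempty (Lottery C) := ⟨x⟩
  hrep.value_of_continuation_eq x rfl fun s => Plan.continuation_prepend x h s

/-- Both sides obey the same recursion and are bounded, so their difference shrinks by the factor
`β` with each unfolding. -/
theorem value_det (hrep : IsSeparableRecursiveRep pref V u β I) {B : ℝ} (hB : ∀ x, |u x| ≤ B)
    (d : ℕ → Lottery C) :
    V (Plan.det d) = lifetimeUtility u β d := by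
  have : Nonempty (Lottery C) := ⟨d 0⟩
  have hβ0 := hrep.beta_pos.le
  have hβ1 := hrep.beta_lt_one
  have hbound : ∀ n, ∀ d : ℕ → Lottery C,
      |V (Plan.det d) - lifetimeUtility u β d| ≤ 2 * (B / (1 - β)) * β ^ n := by
    intro n
    induction n with
    | zero =>
      intro d
      obtain ⟨e, he⟩ := hrep.value_mem_lifetimeRange (Plan.det d)
      have h1 : |V (Plan.det d)| ≤ B / (1 - β) := by
        rw [← he]; exact abs_tsum_discounted_le hβ0 hβ1 fun _ => hB _
      have h2 : |lifetimeUtility u β d| ≤ B / (1 - β) :=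
        abs_tsum_discounted_le hβ0 hβ1 fun _ => hB _
      have := abs_sub (V (Plan.det d)) (lifetimeUtility u β d)
      linarith
    | succ n ih =>
      intro d
      rw [hrep.value_of_continuation_eq (d 0) rfl fun s => Plan.continuation_det d s,
        lifetimeUtility_succ hβ0 hβ1 hB, add_sub_add_left_eq_sub, ← mul_sub, abs_mul,
        abs_of_nonneg hβ0]
      have := mul_le_mul_of_nonneg_left (ih fun t => d (t + 1)) hβ0
      rw [pow_succ]
      linarith
  have hlim : Tendsto (fun n => 2 * (B / (1 - β)) * β ^ n) atTop (𝓝 (2 * (B / (1 - β)) * 0)) :=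
    (tendsto_pow_atTop_nhds_zero_of_lt_one hβ0 hβ1).const_mul _
  rw [mul_zero] at hlim
  have h0 := ge_of_tendsto' hlim fun n => hbound n d
  exact sub_eq_zero.1 (abs_nonpos_iff.1 h0)

theorem value_bet [Finite S] [DiscreteMeasurableSpace S]
    (hrep : IsSeparableRecursiveRep pref V u β I) {B : ℝ} (hB : ∀ x, |u x| ≤ B)
    (x : Lottery C) (y : S → Lottery C) (ξ : BddMeas (lifetimeRange u β) S)
    (hξ : ∀ s, u (y s) / (1 - β) = ξ.1 s) : V (Plan.bet x y) = u x + β * I ξ := by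
  obtain ⟨η, hη, hV⟩ := hrep.recursion (Plan.bet x y)
  have : η = ξ := Subtype.ext <| funext fun s => by
    rw [hη, Plan.continuation_bet, hrep.value_det hB,
      lifetimeUtility_const hrep.beta_pos.le hrep.beta_lt_one, hξ]
  rw [hV fun _ => Classical.arbitrary S, this]
  rfl

/-- State monotonicity makes the value of a plan a monotone and translation invariant function of
its statewise lifetime utility. -/
theorem value_le_value_add (hrep : IsSeparableRecursiveRep pref V u β I)
    (hmon : StateMonotone pref) (haff : IsAffineUtility u)
    (hnonconst : ∃ x y, u x ≠ u y) {B : ℝ} (hB : ∀ x, |u x| ≤ B) (h g : Plan S C) (M : ℝ)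
    (hM : ∀ ω, planUtility u β h ω ≤ planUtility u β g ω + M) : V h ≤ V g + M := by
  have hβ0 := hrep.beta_pos
  have hβ1 := hrep.beta_lt_one
  obtain ⟨x₀, y₀, hw⟩ : ∃ x y, u y < u x := by
    obtain ⟨x, y, hxy⟩ := hnonconst
    rcases hxy.lt_or_gt with h | h
    exacts [⟨y, x, h⟩, ⟨x, y, h⟩]
  have hw' := sub_pos.2 hw
  -- Induction on the number of spreads of `u` that cover the gap; state monotonicity enters only
  -- when the gap is zero.
  have main : ∀ n : ℕ, ∀ (h g : Plan S C) (M : ℝ), |M| ≤ n * (u x₀ - u y₀) →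
      (∀ ω, planUtility u β h ω ≤ planUtility u β g ω + M) → V h ≤ V g + M := by
    intro n
    induction n with
    | zero =>
      intro h g M hn hM
      obtain rfl : M = 0 := by simpa using hn
      rw [add_zero, ← hrep.represents]
      refine hmon g h fun ω => ?_
      rw [hrep.represents, hrep.value_det hB, hrep.value_det hB]
      exact (hM ω).trans_eq (add_zero _)
    | succ n ih =>
      intro h g M hn hM
      have hβM : |β * M| ≤ n * (u x₀ - u y₀) + (u x₀ - u y₀) := by
        rw [abs_mul, abs_of_pos hβ0]
        push_cast at hn
        linarith [mul_le_of_le_one_left (abs_nonneg M) hβ1.le]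
      obtain ⟨c, hc, hc'⟩ := exists_clip (by positivity) hw'.le hβM
      obtain ⟨x, y, hxy⟩ := haff.exists_sub_eq (δ := -c) (by rwa [abs_neg])
      -- As `u x - u y = -c`, the prepended plans have gap `β * M - c`, which `n` spreads cover.
      have := ih (Plan.prepend x h) (Plan.prepend y g) (β * M - c) hc' fun ω => by
        rw [planUtility_prepend hβ0.le hβ1 hB, planUtility_prepend hβ0.le hβ1 hB]
        have := mul_le_mul_of_nonneg_left (hM fun i => ω (i + 1)) hβ0.le
        linarith
      rw [hrep.value_prepend, hrep.value_prepend] at this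
      refine le_of_mul_le_mul_left ?_ hβ0
      linarith
  obtain ⟨n, hn⟩ := exists_nat_ge (|M| / (u x₀ - u y₀))
  exact main n h g M ((div_le_iff₀ hw').1 hn) hM

/-- If plans are evaluated by a variational functional of their statewise lifetime utilities, then
preferences are state monotone. -/
theorem stateMonotone_of_isVariationalMin (hrep : IsSeparableRecursiveRep pref V u β I) {B : ℝ}
    (hB : ∀ x, |u x| ≤ B) {c : FinAddProb (ℕ → S) → ENNReal}
    (hc : ∀ h, IsVariationalMin c (planUtility u β h) (V h)) : StateMonotone pref := by
  intro h g hhg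
  have hβ0 := hrep.beta_pos.le
  have hβ1 := hrep.beta_lt_one
  rw [hrep.represents]
  -- A minimizer for `h` is feasible in the problem for `g`.
  obtain ⟨P, hP⟩ := (hc h).1
  refine EReal.coe_le_coe_iff.1 ?_
  rw [← hP]
  refine ((hc g).2 ⟨P, rfl⟩).trans (add_le_add_left (EReal.coe_le_coe_iff.2 ?_) _)
  refine expectation_mono P (fun ω => (abs_le.1 (abs_planUtility_le hβ0 hβ1 hB g ω)).1)
    (fun ω => (abs_le.1 (abs_planUtility_le hβ0 hβ1 hB h ω)).2) fun ω => ?_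
  have := hhg ω
  rwa [hrep.represents, hrep.value_det hB, hrep.value_det hB] at this

end IsSeparableRecursiveRep

end Representation

/-! ### Concavity from uncertainty aversion. -/

section Concavity

variable {S C : Type*} [Finite S] [MeasurableSpace S] [DiscreteMeasurableSpace S]
  [TopologicalSpace C] [TopologicalSpace.MetrizableSpace C] [MeasurableSpace C] [BorelSpace C]
  {pref : Plan S C → Plan S C → Prop} {V : Plan S C → ℝ} {u : Lottery C → ℝ} {β : ℝ}
  {I : BddMeas (lifetimeRange u β) S → ℝ}

theorem Plan.mix_prepend (α : unitInterval) (x y : Lottery C) (h g : Plan S C) :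
    Plan.mix α (Plan.prepend x h) (Plan.prepend y g) =
      Plan.prepend (Lottery.mix α x y) (Plan.mix α h g) := by
  refine Plan.ext_val fun t => ?_
  cases t <;> rfl

theorem planUtility_mix (haff : IsAffineUtility u) (hβ0 : 0 ≤ β) (hβ1 : β < 1) {B : ℝ}
    (hB : ∀ x, |u x| ≤ B) (α : unitInterval) (h g : Plan S C) (ω : ℕ → S) :
    planUtility u β (Plan.mix α h g) ω =
      α * planUtility u β h ω + (1 - α) * planUtility u β g ω :=
  lifetimeUtility_mix haff hβ0 hβ1 hB α _ _

namespace IsSeparableRecursiveRep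

variable [Nonempty S]

/-- Mixing commutes with prepending and `u` is affine, so the inequality for prepended plans implies
it for `h` and `g`. Prepending shrinks `V h - V g` until the plans are indifferent. -/
theorem le_value_mix (hrep : IsSeparableRecursiveRep pref V u β I) (hua : UncertaintyAverse pref)
    (haff : IsAffineUtility u) (hnonconst : ∃ x y, u x ≠ u y) (α : unitInterval) (hα0 : 0 < α)
    (hα1 : α < 1) (h g : Plan S C) : α * V h + (1 - α) * V g ≤ V (Plan.mix α h g) := by
  have hβ0 := hrep.beta_pos
  have hβ1 := hrep.beta_lt_one
  obtain ⟨x₀, y₀, hw⟩ : ∃ x y, u y < u x := by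
    obtain ⟨x, y, hxy⟩ := hnonconst
    rcases hxy.lt_or_gt with h | h
    exacts [⟨y, x, h⟩, ⟨x, y, h⟩]
  have hw' := sub_pos.2 hw
  have main : ∀ n : ℕ, ∀ h g : Plan S C, |V h - V g| ≤ n * (u x₀ - u y₀) →
      α * V h + (1 - α) * V g ≤ V (Plan.mix α h g) := by
    intro n
    induction n with
    | zero =>
      intro h g hn
      have heq : V h = V g := sub_eq_zero.1 (by simpa using hn)
      have := (hrep.represents _ _).1 (hua h g α hα0 hα1 ((hrep.represents _ _).2 heq.ge)
        ((hrep.represents _ _).2 heq.le))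
      rw [← heq]
      linarith
    | succ n ih =>
      intro h g hn
      have hβM : |β * (V h - V g)| ≤ n * (u x₀ - u y₀) + (u x₀ - u y₀) := by
        rw [abs_mul, abs_of_pos hβ0]
        push_cast at hn
        linarith [mul_le_of_le_one_left (abs_nonneg (V h - V g)) hβ1.le]
      obtain ⟨c, hc, hc'⟩ := exists_clip (by positivity) hw'.le hβM
      obtain ⟨x, y, hxy⟩ := haff.exists_sub_eq (δ := -c) (by rwa [abs_neg])
      have := ih (Plan.prepend x h) (Plan.prepend y g) (by
        rw [hrep.value_prepend, hrep.value_prepend]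
        convert hc' using 2
        linarith)
      rw [Plan.mix_prepend, hrep.value_prepend, hrep.value_prepend, hrep.value_prepend, haff] at this
      refine le_of_mul_le_mul_left ?_ hβ0
      linarith
  obtain ⟨n, hn⟩ := exists_nat_ge (|V h - V g| / (u x₀ - u y₀))
  exact main n h g ((div_le_iff₀ hw').1 hn)

theorem isVariationalFamily_plan (hrep : IsSeparableRecursiveRep pref V u β I)
    (hmon : StateMonotone pref) (hua : UncertaintyAverse pref) (haff : IsAffineUtility u)
    (hnonconst : ∃ x y, u x ≠ u y) {B : ℝ} (hB : ∀ x, |u x| ≤ B) :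
    IsVariationalFamily (planUtility u β) V where
  measurable h := measurable_planUtility hrep.continuous_u hrep.beta_pos.le hrep.beta_lt_one hB h
  bounded h := ⟨_, abs_planUtility_le hrep.beta_pos.le hrep.beta_lt_one hB h⟩
  le_add := hrep.value_le_value_add hmon haff hnonconst hB
  concave h g a b ha hb hab := by
    obtain rfl : b = 1 - a := by linarith
    rcases ha.eq_or_lt with rfl | ha'
    · exact ⟨g, fun ω => by ring, by linarith⟩
    rcases hb.eq_or_lt with hb' | hb'
    · obtain rfl : a = 1 := by linarith
      exact ⟨h, fun ω => by ring, by linarith⟩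
    let α : unitInterval := ⟨a, ha, by linarith⟩
    exact ⟨Plan.mix α h g,
      planUtility_mix haff hrep.beta_pos.le hrep.beta_lt_one hB α h g,
      hrep.le_value_mix hua haff hnonconst α ha' (Subtype.coe_lt_coe.1 (by
        change a < 1
        linarith)) h g⟩
  exists_const := by
    obtain ⟨x, -⟩ := hnonconst
    exact ⟨Plan.det fun _ => x, _, rfl, hrep.value_det hB _⟩

/-- Each `ξ` is realized by a bet with statewise utility `u x + β ξ` and value `u x + β I ξ`, so `I`
inherits the properties of `V`. -/
theorem isVariationalFamily_certaintyEquivalent (hrep : IsSeparableRecursiveRep pref V u β I)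
    (hmon : StateMonotone pref) (hua : UncertaintyAverse pref) (haff : IsAffineUtility u)
    (hnonconst : ∃ x y, u x ≠ u y) {B : ℝ} (hB : ∀ x, |u x| ≤ B) :
    IsVariationalFamily (fun ξ : BddMeas (lifetimeRange u β) S => ξ.1) I := by
  have hβ0 := hrep.beta_pos
  have hβ1 := hrep.beta_lt_one
  have hfam := hrep.isVariationalFamily_plan hmon hua haff hnonconst hB
  obtain ⟨x, -⟩ := hnonconst
  have hbet : ∀ ξ : BddMeas (lifetimeRange u β) S, ∃ h : Plan S C,
      (∀ ω, planUtility u β h ω = u x + β * ξ.1 (ω 0)) ∧ V h = u x + β * I ξ := by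
    intro ξ
    choose y hy using fun s =>
      exists_utility_eq_of_mem_lifetimeRange haff hβ0.le hβ1 hB (ξ.2.2.1 s)
    exact ⟨Plan.bet x y, fun ω => by rw [planUtility_bet hβ0.le hβ1 hB, hy],
      hrep.value_bet hB x y ξ hy⟩
  refine ⟨fun ξ => ξ.2.1, fun ξ => ξ.2.2.2, fun ξ η M hM => ?_, fun ξ η a b ha hb hab => ?_, ?_⟩
  · obtain ⟨h, hh, hVh⟩ := hbet ξ
    obtain ⟨g, hg, hVg⟩ := hbet η
    have := hfam.le_add h g (β * M) fun ω => by
      rw [hh, hg]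
      linarith [mul_le_mul_of_nonneg_left (hM (ω 0)) hβ0.le]
    rw [hVh, hVg] at this
    refine le_of_mul_le_mul_left ?_ hβ0
    linarith
  · let ζ : BddMeas (lifetimeRange u β) S :=
      ⟨fun s => a * ξ.1 s + b * η.1 s, (ξ.2.1.const_mul a).add (η.2.1.const_mul b),
        fun s => convex_lifetimeRange haff hβ0.le hβ1 hB (ξ.2.2.1 s) (η.2.2.1 s) ha hb hab, by
          obtain ⟨M, hM⟩ := (boundedFunctions S).add_mem
            ((boundedFunctions S).smul_mem a ξ.2.2.2) ((boundedFunctions S).smul_mem b η.2.2.2)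
          exact ⟨M, hM⟩⟩
    refine ⟨ζ, fun s => rfl, ?_⟩
    obtain ⟨h, hh, hVh⟩ := hbet ξ
    obtain ⟨g, hg, hVg⟩ := hbet η
    obtain ⟨f, hf, hVf⟩ := hbet ζ
    obtain ⟨k, hk, hVk⟩ := hfam.concave h g a b ha hb hab
    -- The mixture `k` and the bet `f` on `ζ` may be different plans, but their statewise utilities
    -- agree.
    have := hfam.le_add k f 0 fun ω => by
      rw [hk, hh, hg, hf]
      change _ ≤ u x + β * (a * ξ.1 (ω 0) + b * η.1 (ω 0)) + 0
      exact le_of_eq (by linear_combination (u x) * hab)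
    rw [hVf] at this
    rw [hVh, hVg] at hVk
    refine le_of_mul_le_mul_left ?_ hβ0
    have : (a + b) * u x = u x := by rw [hab, one_mul]
    linarith
  · have hx : lifetimeUtility u β (fun _ => x) ∈ lifetimeRange u β := ⟨_, rfl⟩
    refine ⟨⟨fun _ => lifetimeUtility u β fun _ => x, measurable_const, fun _ => hx, _,
      fun _ => le_rfl⟩, _, rfl, hrep.certaintyEquivalent.normalized _ _ hx fun _ => rfl⟩

end IsSeparableRecursiveRep

end Concavity

/-! ### A retraction onto functions with geometrically decaying dependence. -/

section Retraction

/-- The metric projection of `x` onto the interval `[c - r, c + r]`. -/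
def clampAround (c r x : ℝ) : ℝ :=
  max (c - r) (min (c + r) x)

theorem clampAround_le_add {c c' x x' ε : ℝ} (r : ℝ) (hc : c ≤ c' + ε) (hx : x ≤ x' + ε) :
    clampAround c r x ≤ clampAround c' r x' + ε := by
  rw [clampAround, clampAround, ← max_add_add_right, ← min_add_add_right]
  exact max_le_max (by linarith) (min_le_min (by linarith) hx)

theorem abs_clampAround_sub_le {r : ℝ} (hr : 0 ≤ r) (c x : ℝ) : |clampAround c r x - c| ≤ r := by
  have h1 : c - r ≤ clampAround c r x := le_max_left _ _
  have h2 : clampAround c r x ≤ c + r := max_le (by linarith) (min_le_left _ _)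
  rw [abs_le]
  constructor <;> linarith

theorem clampAround_eq_self {c r x : ℝ} (h : |x - c| ≤ r) : clampAround c r x = x := by
  rw [abs_le] at h
  rw [clampAround, min_eq_right (by linarith), max_eq_right (by linarith)]

variable {S : Type*} (s₀ : S) (W β : ℝ)

/-- The state that agrees with `ω` in the first `n` coordinates and equals `s₀` thereafter. -/
def truncateState (n : ℕ) (ω : ℕ → S) : ℕ → S :=
  fun i => if i < n then ω i else s₀

/-- Pointwise convergence is uniform on this finite set of states. -/
theorem finite_range_truncateState [Finite S] (n : ℕ) : (range (truncateState s₀ n)).Finite := by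
  refine (Set.finite_range fun (a : Fin n → S) (i : ℕ) =>
    if hi : i < n then a ⟨i, hi⟩ else s₀).subset ?_
  rintro _ ⟨ω, rfl⟩
  refine ⟨fun i => ω i, funext fun i => ?_⟩
  by_cases hi : i < n <;> simp [truncateState, hi]

/-- Successive projections onto intervals of radius `W * β ^ n` around the values of `ξ` at the
truncations of `ω`, the narrowest interval first. -/
def clampChain (ξ : (ℕ → S) → ℝ) (ω : ℕ → S) : ℕ → ℝ → ℝ
  | 0, x => x
  | n + 1, x => clampChain ξ ω n (clampAround (ξ (truncateState s₀ n ω)) (W * β ^ n) x)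

/-- The `n`-th approximation of the retraction of `ξ`. -/
def retractApprox (ξ : (ℕ → S) → ℝ) (n : ℕ) (ω : ℕ → S) : ℝ :=
  clampChain s₀ W β ξ ω n (ξ (truncateState s₀ n ω))

/-- A monotone and translation invariant retraction onto functions whose dependence on remote
coordinates decays geometrically. It turns pointwise into uniform convergence. -/
def retract (ξ : (ℕ → S) → ℝ) (ω : ℕ → S) : ℝ :=
  limUnder atTop fun n => retractApprox s₀ W β ξ n ω

variable {s₀ W β}

theorem clampChain_le_add {ξ ξ' : (ℕ → S) → ℝ} {ω : ℕ → S} {ε : ℝ} :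
    ∀ {n : ℕ} {x x' : ℝ},
      (∀ i < n, ξ (truncateState s₀ i ω) ≤ ξ' (truncateState s₀ i ω) + ε) → x ≤ x' + ε →
        clampChain s₀ W β ξ ω n x ≤ clampChain s₀ W β ξ' ω n x' + ε
  | 0, _, _, _, hx => hx
  | n + 1, _, _, h, hx =>
    clampChain_le_add (n := n) (fun i hi => h i (hi.trans n.lt_succ_self))
      (clampAround_le_add _ (h n n.lt_succ_self) hx)

theorem retractApprox_le_add {ξ ξ' : (ℕ → S) → ℝ} {ω : ℕ → S} {ε : ℝ} {n : ℕ}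
    (h : ∀ i ≤ n, ξ (truncateState s₀ i ω) ≤ ξ' (truncateState s₀ i ω) + ε) :
    retractApprox s₀ W β ξ n ω ≤ retractApprox s₀ W β ξ' n ω + ε :=
  clampChain_le_add (fun i hi => h i hi.le) (h n le_rfl)

theorem abs_clampChain_sub_le {ξ : (ℕ → S) → ℝ} {ω : ℕ → S} {n : ℕ} {x x' ε : ℝ}
    (h : |x - x'| ≤ ε) :
    |clampChain s₀ W β ξ ω n x - clampChain s₀ W β ξ ω n x'| ≤ ε := by
  have hε : 0 ≤ ε := (abs_nonneg _).trans h
  rw [abs_le] at h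
  have h1 : clampChain s₀ W β ξ ω n x ≤ clampChain s₀ W β ξ ω n x' + ε :=
    clampChain_le_add (fun i _ => by linarith) (by linarith)
  have h2 : clampChain s₀ W β ξ ω n x' ≤ clampChain s₀ W β ξ ω n x + ε :=
    clampChain_le_add (fun i _ => by linarith) (by linarith)
  rw [abs_le]
  constructor <;> linarith

/-- The two approximations feed points at distance at most `W * β ^ n` into the same chain of
nonexpansive projections. -/
theorem dist_retractApprox_succ_le (hW : 0 ≤ W) (hβ0 : 0 ≤ β) (ξ : (ℕ → S) → ℝ) (ω : ℕ → S)
    (n : ℕ) :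
    dist (retractApprox s₀ W β ξ n ω) (retractApprox s₀ W β ξ (n + 1) ω) ≤ W * β ^ n := by
  rw [dist_comm, Real.dist_eq]
  exact abs_clampChain_sub_le (abs_clampAround_sub_le (by positivity) _ _)

theorem tendsto_retractApprox (hW : 0 ≤ W) (hβ0 : 0 ≤ β) (hβ1 : β < 1) (ξ : (ℕ → S) → ℝ)
    (ω : ℕ → S) :
    Tendsto (fun n => retractApprox s₀ W β ξ n ω) atTop (𝓝 (retract s₀ W β ξ ω)) :=
  (cauchySeq_of_le_geometric β W hβ1 (dist_retractApprox_succ_le hW hβ0 ξ ω)).tendsto_limUnder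

theorem abs_retractApprox_sub_retract_le (hW : 0 ≤ W) (hβ0 : 0 ≤ β) (hβ1 : β < 1)
    (ξ : (ℕ → S) → ℝ) (ω : ℕ → S) (n : ℕ) :
    |retractApprox s₀ W β ξ n ω - retract s₀ W β ξ ω| ≤ W * β ^ n / (1 - β) :=
  dist_le_of_le_geometric_of_tendsto β W hβ1 (dist_retractApprox_succ_le hW hβ0 ξ ω)
    (tendsto_retractApprox hW hβ0 hβ1 ξ ω) n

theorem retract_le_add (hW : 0 ≤ W) (hβ0 : 0 ≤ β) (hβ1 : β < 1) {ξ ξ' : (ℕ → S) → ℝ} {ε : ℝ}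
    (h : ∀ ω, ξ ω ≤ ξ' ω + ε) (ω : ℕ → S) : retract s₀ W β ξ ω ≤ retract s₀ W β ξ' ω + ε :=
  le_of_tendsto_of_tendsto' (tendsto_retractApprox hW hβ0 hβ1 ξ ω)
    ((tendsto_retractApprox hW hβ0 hβ1 ξ' ω).add_const ε)
    fun _ => retractApprox_le_add fun _ _ => h _

/-- Under `h` no projection moves `ξ ω`, and the chain is nonexpansive, so the `n`-th approximation
is within `W * β ^ n` of `ξ ω`. -/
theorem retract_eq_self (hW : 0 ≤ W) (hβ0 : 0 ≤ β) (hβ1 : β < 1) {ξ : (ℕ → S) → ℝ} {ω : ℕ → S}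
    (h : ∀ n, |ξ ω - ξ (truncateState s₀ n ω)| ≤ W * β ^ n) : retract s₀ W β ξ ω = ξ ω := by
  have hfix : ∀ n, clampChain s₀ W β ξ ω n (ξ ω) = ξ ω := by
    intro n
    induction n with
    | zero => rfl
    | succ n ih => rw [clampChain, clampAround_eq_self (h n), ih]
  refine tendsto_nhds_unique (tendsto_retractApprox hW hβ0 hβ1 ξ ω) ?_
  have hlim : Tendsto (fun n => W * β ^ n) atTop (𝓝 (W * 0)) :=
    (tendsto_pow_atTop_nhds_zero_of_lt_one hβ0 hβ1).const_mul _
  rw [mul_zero] at hlim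
  refine tendsto_iff_dist_tendsto_zero.2 (squeeze_zero (fun _ => dist_nonneg) (fun n => ?_) hlim)
  rw [dist_comm, Real.dist_eq]
  have := abs_clampChain_sub_le (s₀ := s₀) (W := W) (β := β) (ξ := ξ) (ω := ω) (n := n) (h n)
  rwa [hfix] at this

theorem retract_const (hW : 0 ≤ W) (hβ0 : 0 ≤ β) (hβ1 : β < 1) (k : ℝ) (ω : ℕ → S) :
    retract s₀ W β (fun _ => k) ω = k :=
  retract_eq_self hW hβ0 hβ1 fun n => by
    rw [sub_self, abs_zero]
    positivity

theorem abs_retract_le (hW : 0 ≤ W) (hβ0 : 0 ≤ β) (hβ1 : β < 1) {ξ : (ℕ → S) → ℝ} {M : ℝ}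
    (hM : ∀ ω, |ξ ω| ≤ M) (ω : ℕ → S) : |retract s₀ W β ξ ω| ≤ M := by
  have h1 := retract_le_add (s₀ := s₀) hW hβ0 hβ1 (ξ := ξ) (ξ' := fun _ => 0) (ε := M)
    (fun ω => by linarith [(abs_le.1 (hM ω)).2]) ω
  have h2 := retract_le_add (s₀ := s₀) hW hβ0 hβ1 (ξ := fun _ => 0) (ξ' := ξ) (ε := M)
    (fun ω => by linarith [(abs_le.1 (hM ω)).1]) ω
  rw [retract_const hW hβ0 hβ1] at h1 h2
  rw [abs_le]
  constructor <;> linarith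

/-- Up to an error uniform in `ω` and in the function, the retraction depends only on values at
finitely many truncated states. The three thirds of `ε` are two tails and the difference on these
states. -/
theorem eventually_abs_retract_sub_le [Finite S] (hW : 0 ≤ W) (hβ0 : 0 ≤ β) (hβ1 : β < 1)
    {ξs : ℕ → (ℕ → S) → ℝ} {ξ : (ℕ → S) → ℝ}
    (hlim : ∀ ω, Tendsto (fun n => ξs n ω) atTop (𝓝 (ξ ω))) {ε : ℝ} (hε : 0 < ε) :
    ∀ᶠ n in atTop, ∀ ω, |retract s₀ W β (ξs n) ω - retract s₀ W β ξ ω| ≤ ε := by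
  have h0 : Tendsto (fun N => W * β ^ N / (1 - β)) atTop (𝓝 (W * 0 / (1 - β))) :=
    ((tendsto_pow_atTop_nhds_zero_of_lt_one hβ0 hβ1).const_mul _).div_const _
  rw [mul_zero, zero_div] at h0
  obtain ⟨N, hN⟩ := (h0.eventually_le_const (show (0 : ℝ) < ε / 3 by positivity)).exists
  have hfin : (⋃ i ∈ Set.Iic N, range (truncateState s₀ i)).Finite :=
    (Set.finite_Iic N).biUnion fun i _ => finite_range_truncateState s₀ i
  have hev : ∀ᶠ n in atTop, ∀ ω ∈ ⋃ i ∈ Set.Iic N, range (truncateState s₀ i),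
      |ξs n ω - ξ ω| ≤ ε / 3 :=
    (Filter.eventually_all_finite hfin).2 fun ω _ => by
      filter_upwards [(Metric.tendsto_nhds.1 (hlim ω)) (ε / 3) (by positivity)] with n hn
      exact hn.le
  filter_upwards [hev] with n hn ω
  have hpt : ∀ i ≤ N, |ξs n (truncateState s₀ i ω) - ξ (truncateState s₀ i ω)| ≤ ε / 3 :=
    fun i hi => hn _ (Set.mem_biUnion (Set.mem_Iic.2 hi) ⟨ω, rfl⟩)
  have h1 : retractApprox s₀ W β (ξs n) N ω ≤ retractApprox s₀ W β ξ N ω + ε / 3 :=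
    retractApprox_le_add fun i hi => by linarith [(abs_le.1 (hpt i hi)).2]
  have h2 : retractApprox s₀ W β ξ N ω ≤ retractApprox s₀ W β (ξs n) N ω + ε / 3 :=
    retractApprox_le_add fun i hi => by linarith [(abs_le.1 (hpt i hi)).1]
  have h3 := abs_le.1 ((abs_retractApprox_sub_retract_le (s₀ := s₀) hW hβ0 hβ1 (ξs n) ω N).trans hN)
  have h4 := abs_le.1 ((abs_retractApprox_sub_retract_le (s₀ := s₀) hW hβ0 hβ1 ξ ω N).trans hN)
  rw [abs_le]
  constructor <;> linarith

end Retraction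

/-! ### The smallest extension of a functional. -/

section Extension

variable {ι Y : Type*} [MeasurableSpace Y] {F : ι → Y → ℝ} {v : ι → ℝ}

/-- The smallest monotone and translation invariant extension of the functional `F i ↦ v i`. -/
def lowerExtension (F : ι → Y → ℝ) (v : ι → ℝ) (f : Y → ℝ) : ℝ :=
  sSup {r | ∃ i m, (∀ y, F i y + m ≤ f y) ∧ r = v i + m}

namespace IsVariationalFamily

/-- Bounds the set in `lowerExtension` from above, so that its `sSup` is a genuine supremum. -/
theorem value_add_le (h : IsVariationalFamily F v) {i : ι} {m M : ℝ} (hM : ∀ y, F i y + m ≤ M) :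
    v i + m ≤ M := by
  obtain ⟨j, k, hj, hk⟩ := h.exists_const
  have := h.le_add i j (M - m - k) fun y => by
    rw [hj]
    linarith [hM y]
  linarith

/-- Only bounds on `f` and `f'` are needed, so the retraction need not be measurable or take values
in `lifetimeRange u β`. -/
theorem lowerExtension_le_add (h : IsVariationalFamily F v) {f f' : Y → ℝ} {m M ε : ℝ}
    (hm : ∀ y, m ≤ f y) (hM : ∀ y, f' y ≤ M) (hff' : ∀ y, f y ≤ f' y + ε) :
    lowerExtension F v f ≤ lowerExtension F v f' + ε := by
  obtain ⟨j, k, hj, hk⟩ := h.exists_const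
  refine csSup_le ⟨_, j, m - k, fun y => ?_, rfl⟩ ?_
  · rw [hj]
    linarith [hm y]
  · rintro _ ⟨i, l, hl, rfl⟩
    have : v i + (l - ε) ≤ lowerExtension F v f' := by
      refine le_csSup ⟨M, ?_⟩ ⟨i, l - ε, fun y => by linarith [hl y, hff' y], rfl⟩
      rintro _ ⟨i', l', hl', rfl⟩
      exact h.value_add_le fun y => (hl' y).trans (hM y)
    linarith

theorem lowerExtension_eq (h : IsVariationalFamily F v) (i : ι) :
    lowerExtension F v (F i) = v i := by
  refine IsGreatest.csSup_eq ⟨⟨i, 0, fun y => (add_zero _).le, (add_zero _).symm⟩, ?_⟩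
  rintro _ ⟨j, m, hm, rfl⟩
  linarith [h.le_add j i (-m) fun y => by linarith [hm y]]

end IsVariationalFamily

end Extension

/-! ### Decay of the dependence of plan utility on remote shocks. -/

section DecayOfUtility

variable {S C : Type*} [Finite S] [MeasurableSpace S] [DiscreteMeasurableSpace S]
  [TopologicalSpace C] [TopologicalSpace.MetrizableSpace C] [MeasurableSpace C] [BorelSpace C]
  {u : Lottery C → ℝ} {β : ℝ}

/-- By adaptedness the first `n` terms are unaffected by truncation; each tail is at most `β ^ n *
(B / (1 - β))`. -/
theorem abs_planUtility_sub_truncateState_le (hβ0 : 0 ≤ β) (hβ1 : β < 1) {B : ℝ}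
    (hB : ∀ x, |u x| ≤ B) (s₀ : S) (h : Plan S C) (ω : ℕ → S) (n : ℕ) :
    |planUtility u β h ω - planUtility u β h (truncateState s₀ n ω)| ≤
      2 * (B / (1 - β)) * β ^ n := by
  have hsplit : ∀ ω, planUtility u β h ω = ∑ t ∈ Finset.range n, β ^ t * u (h.val t ω) +
      β ^ n * ∑' t, β ^ t * u (h.val (t + n) ω) := by
    intro ω
    rw [planUtility, lifetimeUtility,
      ← (summable_discounted hβ0 hβ1 fun t => hB (h.val t ω)).sum_add_tsum_nat_add n,
      ← tsum_mul_left]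
    congr 1
    exact tsum_congr fun t => by ring
  have hhead : ∑ t ∈ Finset.range n, β ^ t * u (h.val t ω) =
      ∑ t ∈ Finset.range n, β ^ t * u (h.val t (truncateState s₀ n ω)) := by
    refine Finset.sum_congr rfl fun t ht => ?_
    rw [(measurable_infoAlgebra_iff t _).1 (h.adapted t)]
    intro i hi
    exact (if_pos (lt_trans hi (Finset.mem_range.1 ht))).symm
  have htail : ∀ ω, |∑' t, β ^ t * u (h.val (t + n) ω)| ≤ B / (1 - β) := fun ω =>
    abs_tsum_discounted_le hβ0 hβ1 fun t => hB _
  rw [hsplit, hsplit (truncateState s₀ n ω), hhead, add_sub_add_left_eq_sub, ← mul_sub, abs_mul,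
    abs_of_nonneg (pow_nonneg hβ0 n), mul_comm]
  refine mul_le_mul_of_nonneg_right ?_ (pow_nonneg hβ0 n)
  refine (abs_sub _ _).trans ?_
  linarith [htail ω, htail (truncateState s₀ n ω)]

end DecayOfUtility

/-! ### Cost functions and the ex ante certainty equivalent. -/

section Characterization

variable {S C : Type*} [Finite S] [MeasurableSpace S] [DiscreteMeasurableSpace S]
  [TopologicalSpace C] [TopologicalSpace.MetrizableSpace C] [MeasurableSpace C] [BorelSpace C]
  {pref : Plan S C → Plan S C → Prop} {V : Plan S C → ℝ} {u : Lottery C → ℝ} {β : ℝ}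
  {I : BddMeas (lifetimeRange u β) S → ℝ}

namespace IsSeparableRecursiveRep

variable [Nonempty S]

theorem exists_costFunctions (hrep : IsSeparableRecursiveRep pref V u β I)
    (hmon : StateMonotone pref) (hua : UncertaintyAverse pref) (haff : IsAffineUtility u)
    (hnonconst : ∃ x y, u x ≠ u y) {B : ℝ} (hB : ∀ x, |u x| ≤ B) :
    ∃ (c₁ : FinAddProb S → ENNReal) (c₀ : FinAddProb (ℕ → S) → ENNReal),
      IsCostFunction c₁ ∧ IsCostFunction c₀ ∧
      ∀ h : Plan S C,
        (∃ m : ℝ, IsVariationalMin c₁ (fun s => V (h.continuation s)) m ∧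
          ∀ ω, V h = u (h.val 0 ω) + β * m) ∧
        IsVariationalMin c₀ (planUtility u β h) (V h) := by
  have h₁ := hrep.isVariationalFamily_certaintyEquivalent hmon hua haff hnonconst hB
  have h₀ := hrep.isVariationalFamily_plan hmon hua haff hnonconst hB
  refine ⟨_, _, h₁.isCostFunction, h₀.isCostFunction, fun h => ⟨?_, h₀.isVariationalMin h⟩⟩
  obtain ⟨ξ, hξ, hV⟩ := hrep.recursion h
  refine ⟨I ξ, ?_, hV⟩
  rw [← funext hξ]
  exact h₁.isVariationalMin ξ

theorem exists_certaintyEquivalent (hrep : IsSeparableRecursiveRep pref V u β I)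
    (hmon : StateMonotone pref) (hua : UncertaintyAverse pref) (haff : IsAffineUtility u)
    (hnonconst : ∃ x y, u x ≠ u y) {B : ℝ} (hB : ∀ x, |u x| ≤ B) :
    ∃ I₀ : BddMeas (lifetimeRange u β) (ℕ → S) → ℝ,
      IsCertaintyEquivalent I₀ ∧ IsTranslationInvariant I₀ ∧
      ∀ h : Plan S C, ∃ ξ : BddMeas (lifetimeRange u β) (ℕ → S),
        (∀ ω, ξ.1 ω = planUtility u β h ω) ∧ V h = I₀ ξ := by
  have hfam := hrep.isVariationalFamily_plan hmon hua haff hnonconst hB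
  have hβ0 := hrep.beta_pos.le
  have hβ1 := hrep.beta_lt_one
  obtain ⟨x, -⟩ := hnonconst
  have hW : 0 ≤ 2 * (B / (1 - β)) :=
    mul_nonneg zero_le_two (div_nonneg ((abs_nonneg _).trans (hB x)) (sub_nonneg.2 hβ1.le))
  let s₀ : S := Classical.arbitrary S
  let T := retract s₀ (2 * (B / (1 - β))) β
  -- The radius of the retraction is the decay constant of plan utilities, which are therefore fixed
  -- points.
  have hT : ∀ h : Plan S C, T (planUtility u β h) = planUtility u β h := fun h =>
    funext fun ω => retract_eq_self hW hβ0 hβ1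
      (abs_planUtility_sub_truncateState_le hβ0 hβ1 hB s₀ h ω)
  let I₀ : BddMeas (lifetimeRange u β) (ℕ → S) → ℝ := fun ξ =>
    lowerExtension (planUtility u β) V (T ξ.1)
  have hI₀ : ∀ h : Plan S C, ∀ ξ : BddMeas (lifetimeRange u β) (ℕ → S),
      ξ.1 = planUtility u β h → I₀ ξ = V h := by
    intro h ξ hξ
    change lowerExtension (planUtility u β) V (T ξ.1) = V h
    rw [hξ, hT, hfam.lowerExtension_eq]
  have hlip : ∀ (ξ ξ' : BddMeas (lifetimeRange u β) (ℕ → S)) (ε : ℝ),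
      (∀ ω, T ξ.1 ω ≤ T ξ'.1 ω + ε) → I₀ ξ ≤ I₀ ξ' + ε := by
    intro ξ ξ' ε h
    obtain ⟨M, hM⟩ := ξ.2.2.2
    obtain ⟨M', hM'⟩ := ξ'.2.2.2
    exact hfam.lowerExtension_le_add (fun ω => (abs_le.1 (abs_retract_le hW hβ0 hβ1 hM ω)).1)
      (fun ω => (abs_le.1 (abs_retract_le hW hβ0 hβ1 hM' ω)).2) h
  refine ⟨I₀, ⟨fun ξs ξ hlim => ?_, fun ξ ξ' h => ?_, fun ξ k hk h => ?_⟩, fun ξ ξ' k h => ?_,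
    fun h => ?_⟩
  · refine Metric.tendsto_nhds.2 fun ε hε => ?_
    filter_upwards [eventually_abs_retract_sub_le (s₀ := s₀) hW hβ0 hβ1 hlim (half_pos hε)]
      with n hn
    have h1 := hlip (ξs n) ξ (ε / 2) fun ω => by linarith [(abs_le.1 (hn ω)).2]
    have h2 := hlip ξ (ξs n) (ε / 2) fun ω => by linarith [(abs_le.1 (hn ω)).1]
    rw [Real.dist_eq, abs_lt]
    constructor <;> linarith
  · have := hlip ξ' ξ 0 (retract_le_add hW hβ0 hβ1 fun ω => by linarith [h ω])
    linarith
  · obtain ⟨d, rfl⟩ := hk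
    rw [hI₀ (Plan.det d) ξ (funext h), hrep.value_det hB]
  · have h1 := hlip ξ' ξ k (retract_le_add hW hβ0 hβ1 fun ω => (h ω).le)
    have h2 := hlip ξ ξ' (-k) (retract_le_add hW hβ0 hβ1 fun ω => by linarith [h ω])
    linarith
  · exact ⟨⟨planUtility u β h, hfam.measurable h, fun ω => ⟨_, rfl⟩, hfam.bounded h⟩,
      fun _ => rfl, (hI₀ h _ rfl).symm⟩

end IsSeparableRecursiveRep

end Characterization

end

theorem corollary2 {S C : Type*} [Finite S] [MeasurableSpace S] [DiscreteMeasurableSpace S]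
    (hS : 3 ≤ Nat.card S) [TopologicalSpace C] [CompactSpace C]
    [TopologicalSpace.MetrizableSpace C] [Nontrivial C] [MeasurableSpace C] [BorelSpace C]
    (pref : Plan S C → Plan S C → Prop) (V : Plan S C → ℝ) (u : Lottery C → ℝ) (β : ℝ)
    (I : BddMeas (lifetimeRange u β) S → ℝ) (hrep : IsSeparableRecursiveRep pref V u β I)
    (haff : IsAffineUtility u) (hnonconst : ∃ x y, u x ≠ u y) (hua : UncertaintyAverse pref) :
    (StateMonotone pref ↔
      ∃ (c₁ : FinAddProb S → ENNReal) (c₀ : FinAddProb (ℕ → S) → ENNReal),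
        IsCostFunction c₁ ∧ IsCostFunction c₀ ∧
        ∀ h : Plan S C,
          (∃ m : ℝ, IsVariationalMin c₁ (fun s => V (h.continuation s)) m ∧
            ∀ ω, V h = u (h.val 0 ω) + β * m) ∧
          IsVariationalMin c₀ (fun ω => lifetimeUtility u β fun t => h.val t ω) (V h)) ∧
    (StateMonotone pref →
      ∃ I₀ : BddMeas (lifetimeRange u β) (ℕ → S) → ℝ,
        IsCertaintyEquivalent I₀ ∧ IsTranslationInvariant I₀ ∧
        ∀ h : Plan S C, ∃ ξ : BddMeas (lifetimeRange u β) (ℕ → S),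
          (∀ ω, ξ.1 ω = lifetimeUtility u β fun t => h.val t ω) ∧ V h = I₀ ξ) := by
  have : Nonempty S := (Nat.card_pos_iff.1 (by omega)).1
  obtain ⟨B, hB⟩ := exists_abs_utility_le hrep.continuous_u
  refine ⟨⟨fun hmon => hrep.exists_costFunctions hmon hua haff hnonconst hB, ?_⟩,
    fun hmon => hrep.exists_certaintyEquivalent hmon hua haff hnonconst hB⟩
  rintro ⟨c₁, c₀, -, -, h⟩
  exact hrep.stateMonotone_of_isVariationalMin hB fun g => (h g).2
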